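/- Let $d\ge 2$ and let $\Phi=\{\phi_i(x)=T_ix+a_i\}_{i=1}^{\ell}$ be an affine iterated function system on $\mathbb{R}^d$, i.e. a finite family of affine maps with invertible $T_i\in\mathbb{R}^{d\times d}$ and $a_i\in\mathbb{R}^d$ for which there is $0<c<1$ with $|\phi_i(x)-\phi_i(y)|\le c|x-y|$ (Euclidean norm) for all $i$ and all $x,y\in\mathbb{R}^d$. Let $E$ be its attractor, i.e. the unique non-empty compact set with $E=\bigcup_{i=1}^{\ell}\phi_i(E)$, and suppose that $E$ is not contained in any (affine) hyperplane of $\mathbb{R}^d$. Suppose that at least one of the following conditions holds: (i) $T_iT_j=T_jT_i$ for all $1\le i,j\le \ell$; (ii) $(T_1,\dots,T_\ell)$ is irreducible, i.e. there is no linear subspace $V$ of $\mathbb{R}^d$ with $\{0\}\ne V\ne\mathbb{R}^d$ and $T_iV\subset V$ for all $i$; and the multiplicative semigroup generated by $T_1,\dots,T_\ell$ contains a matrix $M$ with a simple dominant eigenvalue, i.e. $M$ has an eigenvalue $\lambda$ of algebraic multiplicity $1$ such that $|\lambda|>|\mu|$ for every other (complex) eigenvalue $\mu$ of $M$; (iii)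 $d=2$. Then $E$ is arithmetically thick: there is a positive integer $n$ such that the $n$-fold arithmetic sum $\{x_1+\dots+x_n : x_1,\dots,x_n\in E\}$ has non-empty interior in $\mathbb{R}^d$. -/

import Mathlib

namespace SelfAffine

/-- The affine map `x ↦ T x + a` on Euclidean space `ℝ^d`. -/
noncomputable def affMap {d : ℕ} (T : Matrix (Fin d) (Fin d) ℝ) (a : EuclideanSpace ℝ (Fin d)) :
    EuclideanSpace ℝ (Fin d) → EuclideanSpace ℝ (Fin d) :=
  fun x => Matrix.toEuclideanLin T x + a

/-- `{x ↦ T i x + a i}` is an affine iterated function system: a finite family of invertible affine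
maps of `ℝ^d` which are uniformly contracting for the Euclidean distance. -/
def IsAffineIFS {d l : ℕ} (T : Fin l → Matrix (Fin d) (Fin d) ℝ)
    (a : Fin l → EuclideanSpace ℝ (Fin d)) : Prop :=
  (∀ i, IsUnit (T i)) ∧
    ∃ c : ℝ, 0 < c ∧ c < 1 ∧
      ∀ i x y, dist (affMap (T i) (a i) x) (affMap (T i) (a i) y) ≤ c * dist x y

/-- `E` is the attractor of the system `φ`: the non-empty compact set with `E = ⋃ i, φ i (E)`. -/
def IsAttractor {d l : ℕ} (φ : Fin l → EuclideanSpace ℝ (Fin d) → EuclideanSpace ℝ (Fin d))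
    (E : Set (EuclideanSpace ℝ (Fin d))) : Prop :=
  E.Nonempty ∧ IsCompact E ∧ E = ⋃ i, φ i '' E

/-- An (affine) hyperplane `{x : ⟨v, x⟩ = b}`, `v ≠ 0`, of `ℝ^d`. -/
def IsHyperplane {d : ℕ} (H : Set (EuclideanSpace ℝ (Fin d))) : Prop :=
  ∃ v : EuclideanSpace ℝ (Fin d), v ≠ 0 ∧ ∃ b : ℝ, H = {x | inner ℝ v x = b}

/-- The `n`-fold arithmetic sum `{x_1 + ⋯ + x_n : x_i ∈ E}`. -/
def nFoldSum {d : ℕ} (n : ℕ) (E : Set (EuclideanSpace ℝ (Fin d))) :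
    Set (EuclideanSpace ℝ (Fin d)) :=
  {y | ∃ x : Fin n → EuclideanSpace ℝ (Fin d), (∀ i, x i ∈ E) ∧ y = ∑ i, x i}

/-- Some `n`-fold arithmetic sum of `E`, `n ≥ 1`, has non-empty interior. -/
def ArithmeticallyThick {d : ℕ} (E : Set (EuclideanSpace ℝ (Fin d))) : Prop :=
  ∃ n : ℕ, 1 ≤ n ∧ (interior (nFoldSum n E)).Nonempty

/-- No linear subspace other than `0` and `ℝ^d` is invariant under all the matrices. -/
def IrreducibleTuple {d l : ℕ} (M : Fin l → Matrix (Fin d) (Fin d) ℝ) : Prop :=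
  ∀ V : Submodule ℝ (EuclideanSpace ℝ (Fin d)),
    (∀ i, ∀ v ∈ V, Matrix.toEuclideanLin (M i) v ∈ V) → V = ⊥ ∨ V = ⊤

/-- Some (complex) eigenvalue of `M` has algebraic multiplicity `1` and is of strictly larger
modulus than every other complex eigenvalue. -/
def HasSimpleDominantEigenvalue {d : ℕ} (M : Matrix (Fin d) (Fin d) ℝ) : Prop :=
  ∃ z : ℂ, (M.map (algebraMap ℝ ℂ)).charpoly.rootMultiplicity z = 1 ∧
    ∀ w : ℂ, (M.map (algebraMap ℝ ℂ)).charpoly.IsRoot w → w ≠ z → ‖w‖ < ‖z‖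

end SelfAffine

/-! Greedy expansion. Write a target point as a sum of `N` centres of pieces `g(E)`, where `g` is a
product of maps of the system, plus a residual measured in a frame `Q k` attached to the level `k`.
Refining a piece moves its centre. If every piece of level `k` has a refinement whose displacement,
in the frame `Q k`, is bounded and correlates with any given residual, then one sweep over `N`
pieces, `N` large, brings the residual below an absolute constant, and the change to `Q (k + 1)`
costs a bounded factor. The residual thus stays bounded in frames tending to zero, and compactness
puts a whole ball into a multiple sum of `E`: this is `exists_interior_of_refinement`.

Correlation is arranged by centring a finite family `F` of contractions at its barycentre `c`, where
`∑ s, (F s c - c) = 0`. For a piece with linear part `A` the numbers `⟪y, A (F s c - c)⟫` sum to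
zero, so the largest is a fixed share of the sum of their absolute values. Only a lower bound for
that sum is needed, uniform in `A` relative to the frame. Scalar frames give `thick_of_scale`;
frames `D ^ k` give `thick_of_frame`, which allows strongly non-conformal maps. Its consequence
`thick_of_commuting` applies when pairs of maps with equal linear parts have translation differences
that span.

Commuting linear parts: `g * φ i` and `φ i * g` form such a pair, and the differences span because
`E` lies in no hyperplane. Irreducible with a simple dominant eigenvalue: the normalised powers of
the proximal element tend to a rank-one projection, suitable maps preserve a cone, and on the cone
the norm of a product is seen by a single functional; irreducibility spreads the dominant direction
over the space (`IsSystem.thick_of_proximal`).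

Plane, irreducible: either the monoid has a strictly contracting proximal element, or `trace ^ 2 ≤ 4
* |det|` throughout, which forces bounded distortion (`exists_adjoint_lower_bound`,
`IsSystem.thick_of_conformal`). Plane, reducible and non-commuting: the linear parts are triangular,
and the diagonal entries `a i` (invariant line) and `c i` (quotient) are compared. If `|a i| < |c
i|` for some `i`, the proximal criterion applies; if `|c i| ≤ |a i|` always and strictly once,
products with equal diagonal stay within bounded shears of powers of one map; if the moduli always
agree, a submonoid with commuting linear parts suffices. -/

open Filter Topology
open scoped Pointwise InnerProductSpace

/-! ### Affine self-maps as a monoid, and barycentres of families of contractions. -/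

namespace SelfAffine

/-- Affine self-maps `x ↦ lin x + tr` of a normed space. -/
@[ext]
structure AffEnd (V : Type*) [NormedAddCommGroup V] [NormedSpace ℝ V] where
  /-- the linear part -/
  lin : V →L[ℝ] V
  /-- the translation part -/
  tr : V

namespace AffEnd

variable {V : Type*} [NormedAddCommGroup V] [NormedSpace ℝ V]

/-- Evaluation of an affine self-map. -/
def app (g : AffEnd V) (x : V) : V := g.lin x + g.tr

instance : CoeFun (AffEnd V) (fun _ => V → V) := ⟨app⟩

theorem apply_def (g : AffEnd V) (x : V) : g x = g.lin x + g.tr := rfl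

instance : Mul (AffEnd V) := ⟨fun g h => ⟨g.lin * h.lin, g.lin h.tr + g.tr⟩⟩

instance : One (AffEnd V) := ⟨⟨1, 0⟩⟩

@[simp] theorem mul_lin (g h : AffEnd V) : (g * h).lin = g.lin * h.lin := rfl

@[simp] theorem one_lin : (1 : AffEnd V).lin = 1 := rfl

theorem mul_tr (g h : AffEnd V) : (g * h).tr = g.lin h.tr + g.tr := rfl

theorem one_tr : (1 : AffEnd V).tr = 0 := rfl

instance : Monoid (AffEnd V) where
  mul_assoc f g h := by
    ext1
    · simp [mul_assoc]
    · simp [mul_tr, add_assoc]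
  one_mul f := by ext1 <;> simp [mul_tr, one_tr]
  mul_one f := by ext1 <;> simp [mul_tr, one_tr]

theorem mul_apply (g h : AffEnd V) (x : V) : (g * h) x = g (h x) := by
  simp [apply_def, mul_tr, add_assoc]

theorem one_apply (x : V) : (1 : AffEnd V) x = x := by simp [apply_def, one_tr]

@[simp] theorem pow_lin (g : AffEnd V) (k : ℕ) : (g ^ k).lin = g.lin ^ k := by
  induction k with
  | zero => simp
  | succ k ih => simp [pow_succ, ih]

theorem apply_sub_apply (g : AffEnd V) (x y : V) : g x - g y = g.lin (x - y) := by
  simp [apply_def]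

theorem apply_eq_apply_add (g : AffEnd V) (x y : V) : g x = g y + g.lin (x - y) := by
  rw [← apply_sub_apply]; abel

theorem pow_apply_of_fixed {g : AffEnd V} {p : V} (h : g p = p) (k : ℕ) : (g ^ k) p = p := by
  induction k with
  | zero => rw [pow_zero, one_apply]
  | succ k ih => rw [pow_succ, mul_apply, h, ih]

theorem pow_apply_sub {g : AffEnd V} {p : V} (h : g p = p) (k : ℕ) (x : V) :
    (g ^ k) x - p = (g.lin ^ k) (x - p) := by
  conv_lhs => rw [← pow_apply_of_fixed h k]
  rw [apply_sub_apply, pow_lin]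

/-- A finite family of strict contractions has a common barycentre. -/
theorem exists_barycentre [CompleteSpace V] {ι : Type*} [Fintype ι] [Nonempty ι]
    (F : ι → AffEnd V) {θ : ℝ} (hθ : θ < 1) (hF : ∀ s, ‖(F s).lin‖ ≤ θ) :
    ∃ c : V, ∑ s, (F s c - c) = 0 := by
  set n : ℝ := (Fintype.card ι : ℝ)
  have hn : 0 < n := by simp [n, Fintype.card_pos]
  -- The barycentre is the fixed point of the average of the maps, whose linear part `L` is again a
  -- strict contraction.
  set L : V →L[ℝ] V := n⁻¹ • ∑ s, (F s).lin
  have hL : ‖L‖ < 1 := by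
    refine lt_of_le_of_lt ?_ hθ
    calc ‖L‖ ≤ n⁻¹ * ‖∑ s, (F s).lin‖ := by
          rw [norm_smul, norm_inv, Real.norm_of_nonneg hn.le]
      _ ≤ n⁻¹ * ∑ s : ι, θ := by
          gcongr
          exact norm_sum_le_of_le _ fun s _ => hF s
      _ = θ := by simp [n]
  obtain ⟨u, hu⟩ := isUnit_one_sub_of_norm_lt_one hL
  refine ⟨(↑u⁻¹ : V →L[ℝ] V) (n⁻¹ • ∑ s, (F s).tr), ?_⟩
  set c := (↑u⁻¹ : V →L[ℝ] V) (n⁻¹ • ∑ s, (F s).tr) with hc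
  have h1 : (1 - L) c = n⁻¹ • ∑ s, (F s).tr := by
    rw [← hu, hc, ← mul_apply_eq_comp, Units.mul_inv]; rfl
  have h2 : n • ((1 - L) c) = ∑ s, (F s).tr := by
    rw [h1, smul_smul, mul_inv_cancel₀ hn.ne', one_smul]
  have h3 : n • L c = ∑ s, (F s).lin c := by
    simp [L, smul_smul, hn.ne']
  have h4 : n • c = ∑ s : ι, c := by simp [n, Nat.cast_smul_eq_nsmul]
  simp only [apply_def, Finset.sum_sub_distrib, Finset.sum_add_distrib]
  rw [← h2, ← h3, ← h4]
  simp [smul_sub]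

/-- A strict contraction has a fixed point. -/
theorem exists_fixed [CompleteSpace V] (g : AffEnd V) (hg : ‖g.lin‖ < 1) : ∃ p : V, g p = p := by
  obtain ⟨c, hc⟩ := exists_barycentre (fun _ : Unit => g) hg (fun _ => le_rfl)
  exact ⟨c, sub_eq_zero.1 (by simpa using hc)⟩

/-- Precomposing a finite family with a high power of a contraction moves the values at the
barycentre close to the values at the fixed point. -/
theorem barycentre_near {ι : Type*} [Fintype ι] [Nonempty ι] (ψ : ι → AffEnd V)
    (hψ : ∀ s, ‖(ψ s).lin‖ ≤ 1) (g : AffEnd V) (hg : ‖g.lin‖ < 1) {p : V} (hp : g p = p)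
    {ε : ℝ} (hε : 0 < ε) :
    ∀ᶠ k : ℕ in atTop, ∀ c : V, ∑ s, ((ψ s * g ^ k) c - c) = 0 →
      ‖(g ^ k) c - p‖ ≤ ε ∧ ∀ s, ‖(ψ s * g ^ k) c - ψ s p‖ ≤ ε := by
  set D : ℝ := ∑ s, ‖ψ s p - p‖ with hD
  have hD0 : 0 ≤ D := by positivity
  have hlim : Tendsto (fun k : ℕ => ‖g.lin ^ k‖) atTop (𝓝 0) := by
    have := tendsto_pow_atTop_nhds_zero_of_norm_lt_one hg
    simpa using this.norm
  have hη : 0 < min (1 / 2) (ε / (2 * D + 1)) := by positivity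
  filter_upwards [hlim.eventually (gt_mem_nhds hη)] with k hk c hc
  have hk1 : ‖g.lin ^ k‖ ≤ 1 / 2 := hk.le.trans (min_le_left _ _)
  have hk2 : ‖g.lin ^ k‖ ≤ ε / (2 * D + 1) := hk.le.trans (min_le_right _ _)
  set q := (g ^ k) c with hq
  have hqp : ‖q - p‖ ≤ ‖g.lin ^ k‖ * ‖c - p‖ := by
    rw [hq, pow_apply_sub hp]; exact ContinuousLinearMap.le_opNorm _ _
  have hψq : ∀ s, ‖ψ s q - ψ s p‖ ≤ ‖q - p‖ := fun s => by
    rw [apply_sub_apply]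
    exact ((ψ s).lin.le_opNorm _).trans (mul_le_of_le_one_left (norm_nonneg _) (hψ s))
  have hn : (1 : ℝ) ≤ Fintype.card ι := by exact_mod_cast Fintype.card_pos
  -- Each `ψ s q` is within `‖c - p‖ / 2` of `ψ s p`, so averaging absorbs half of `‖c - p‖`. The
  -- bound does not involve `k`, which is why `k` can be chosen before `c`.
  have hcp : ‖c - p‖ ≤ 2 * D := by
    have h1 : (Fintype.card ι : ℝ) • (c - p) = ∑ s, ((ψ s q - ψ s p) + (ψ s p - p)) := by
      have : ∑ s, ((ψ s * g ^ k) c - c) = ∑ s, (((ψ s q - ψ s p) + (ψ s p - p)) - (c - p)) := by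
        refine Finset.sum_congr rfl fun s _ => ?_
        rw [mul_apply]; abel
      rw [this, Finset.sum_sub_distrib, sub_eq_zero] at hc
      rw [hc, Nat.cast_smul_eq_nsmul, Finset.sum_const, Finset.card_univ]
    have h2 : (Fintype.card ι : ℝ) * ‖c - p‖ ≤ Fintype.card ι * (1 / 2 * ‖c - p‖) + D := by
      calc (Fintype.card ι : ℝ) * ‖c - p‖ = ‖(Fintype.card ι : ℝ) • (c - p)‖ := by
            rw [norm_smul]; simp
        _ ≤ ∑ s : ι, (1 / 2 * ‖c - p‖ + ‖ψ s p - p‖) := by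
            rw [h1]
            refine norm_sum_le_of_le _ fun s _ => (norm_add_le _ _).trans ?_
            gcongr
            exact (hψq s).trans (hqp.trans (by gcongr))
        _ = _ := by simp [Finset.sum_add_distrib, hD]
    nlinarith [norm_nonneg (c - p)]
  have hfin : ‖q - p‖ ≤ ε := by
    calc ‖q - p‖ ≤ ε / (2 * D + 1) * (2 * D) := hqp.trans (by gcongr)
      _ ≤ ε := by
        rw [div_mul_eq_mul_div, div_le_iff₀ (by positivity)]; nlinarith
  exact ⟨hfin, fun s => by rw [mul_apply]; exact (hψq s).trans hfin⟩

end AffEnd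

/-! ### Multiple sums of a set. -/

section Sums

variable {V : Type*} [NormedAddCommGroup V]

theorem list_sum_near {σ : Type*} {E : Set V} {m : ℕ} (ctr : σ → V) {e : ℝ} (l : List σ)
    (h : ∀ P ∈ l, ∃ x ∈ m • E, ‖ctr P - x‖ ≤ e) :
    ∃ x ∈ (l.length * m) • E, ‖(l.map ctr).sum - x‖ ≤ l.length * e := by
  induction l with
  | nil => exact ⟨0, by simp, by simp⟩
  | cons P l ih =>
    obtain ⟨x, hx, hxe⟩ := h P (by simp)
    obtain ⟨y, hy, hye⟩ := ih fun R hR => h R (by simp [hR])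
    refine ⟨x + y, ?_, ?_⟩
    · rw [List.length_cons, add_mul, one_mul, add_comm, add_nsmul]
      exact Set.add_mem_add hx hy
    · have : ((P :: l).map ctr).sum - (x + y) = (ctr P - x) + ((l.map ctr).sum - y) := by
        simp; abel
      rw [this]
      push_cast [List.length_cons]
      linarith [norm_add_le (ctr P - x) ((l.map ctr).sum - y)]

theorem isCompact_nsmul {E : Set V} (hE : IsCompact E) (n : ℕ) : IsCompact (n • E) := by
  induction n with
  | zero => simp
  | succ n ih => rw [succ_nsmul]; exact ih.add hE

end Sums

/-! ### The greedy refinement argument, and uniform non-orthogonality. -/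

section Greedy

variable {V : Type*} [NormedAddCommGroup V] [InnerProductSpace ℝ V]

/-- A step that correlates with the residual shortens it, unless it is already short. -/
theorem norm_sub_le_of_inner {z a : V} {δ C : ℝ} (hδ : 0 < δ) (hC : δ ≤ C)
    (h : δ * ‖z‖ ≤ ⟪z, a⟫_ℝ) (ha : ‖a‖ ≤ C) :
    ‖z - a‖ ≤ max (‖z‖ - δ / 2) (C ^ 2 / δ + C) := by
  -- Beyond `C ^ 2 / δ` the gain `2 δ ‖z‖` in the squared norm pays for `‖a‖ ^ 2` and still leaves
  -- `δ ‖z‖`, enough to reach `(‖z‖ - δ / 2) ^ 2`. Below that radius the triangle inequality is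
  -- enough.
  rcases le_or_gt (C ^ 2 / δ) ‖z‖ with hz | hz
  · refine le_max_of_le_left ?_
    have h1 : C ^ 2 ≤ ‖z‖ * δ := (div_le_iff₀ hδ).1 hz
    have h2 : ‖z - a‖ ^ 2 = ‖z‖ ^ 2 - 2 * ⟪z, a⟫_ℝ + ‖a‖ ^ 2 := norm_sub_sq_real z a
    have h3 : ‖a‖ ^ 2 ≤ C ^ 2 := by gcongr
    have h4 : δ ≤ ‖z‖ := by
      have : δ * δ ≤ ‖z‖ * δ := by nlinarith
      exact le_of_mul_le_mul_right this hδ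
    refine abs_le_of_sq_le_sq' ?_ (by linarith) |>.2
    nlinarith
  · refine le_max_of_le_right ?_
    calc ‖z - a‖ ≤ ‖z‖ + ‖a‖ := norm_sub_le _ _
      _ ≤ _ := by gcongr

/-- One sweep over a list of pieces. -/
theorem exists_sweep {σ : Type*} {A B : Set σ} (ctr : σ → V) (Q : V →L[ℝ] V) {δ C : ℝ}
    (hδ : 0 < δ) (hC : δ ≤ C)
    (H : ∀ P ∈ A, ∀ z : V, ∃ P' ∈ B, ∃ a : V, ctr P' - ctr P = Q a ∧ δ * ‖z‖ ≤ ⟪z, a⟫_ℝ ∧ ‖a‖ ≤ C)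
    (l : List σ) (hl : ∀ P ∈ l, P ∈ A) (z : V) :
    ∃ l' : List σ, l'.length = l.length ∧ (∀ P ∈ l', P ∈ B) ∧ ∃ z' : V,
      (l.map ctr).sum + Q z = (l'.map ctr).sum + Q z' ∧
      ‖z'‖ ≤ max (‖z‖ - l.length * (δ / 2)) (C ^ 2 / δ + C) := by
  induction l generalizing z with
  | nil => exact ⟨[], rfl, by simp, z, by simp, by simp⟩
  | cons P l ih =>
    obtain ⟨P', hP', a, ha, hza, haC⟩ := H P (hl P (by simp)) z
    obtain ⟨l', hlen, hB, z', hsum, hz'⟩ := ih (fun R hR => hl R (by simp [hR])) (z - a)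
    refine ⟨P' :: l', by simp [hlen], ?_, z', ?_, ?_⟩
    · simpa using ⟨hP', hB⟩
    · simp only [List.map_cons, List.sum_cons, map_sub] at hsum ⊢
      rw [add_assoc, add_assoc, ← hsum, ← ha]; abel
    · refine hz'.trans ?_
      have h1 := norm_sub_le_of_inner hδ hC hza haC
      have h2 : (0 : ℝ) ≤ l.length * (δ / 2) := by positivity
      have h3 : (0 : ℝ) ≤ δ / 2 := by positivity
      push_cast [List.length_cons]
      refine max_le ?_ (le_max_right _ _)
      rcases le_max_iff.1 h1 with h | h
      · exact le_max_of_le_left (by nlinarith)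
      · exact le_max_of_le_right (by linarith)

/-- Sums of sufficiently many copies of `E` have interior, as soon as residuals can be reduced
at every scale by refining a piece. -/
theorem exists_interior_of_refinement {σ : Type*} {E : Set V} (hE : IsCompact E) {m : ℕ}
    (hm : 1 ≤ m) (lev : ℕ → Set σ) (ctr : σ → V) (Q : ℕ → V →L[ℝ] V) {δ C C' : ℝ} (hδ : 0 < δ)
    (hC : δ ≤ C) (hne : (lev 0).Nonempty)
    (hQ0 : Q 0 = 1)
    (hQ : ∀ k z, ∃ z', Q k z = Q (k + 1) z' ∧ ‖z'‖ ≤ C' * ‖z‖)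
    (hlim : Tendsto Q atTop (𝓝 0))
    (H : ∀ k, ∀ P ∈ lev k, ∀ z : V, ∃ P' ∈ lev (k + 1), ∃ a : V,
      ctr P' - ctr P = Q k a ∧ δ * ‖z‖ ≤ ⟪z, a⟫_ℝ ∧ ‖a‖ ≤ C)
    (e : ℕ → ℝ) (he : Tendsto e atTop (𝓝 0))
    (hreal : ∀ k, ∀ P ∈ lev k, ∃ x ∈ m • E, ‖ctr P - x‖ ≤ e k) :
    ∃ n : ℕ, 1 ≤ n ∧ (interior (n • E)).Nonempty := by
  obtain ⟨P0, hP0⟩ := hne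
  -- `K` is the length guaranteed after a full sweep, `R` makes room for the factor `C'` of a change
  -- of frame, and `N` steps of gain `δ / 2` bring any residual of length at most `R` down to `K`.
  set K := C ^ 2 / δ + C with hK
  have hC0 : 0 < C := hδ.trans_le hC
  have hK0 : 0 < K := by positivity
  set R := max (C' * K) 1 with hR
  obtain ⟨N, hN⟩ := exists_nat_gt (R / (δ / 2))
  have hR0 : 0 < R := lt_max_of_lt_right one_pos
  have hN0 : 1 ≤ N := by
    have : (0 : ℝ) < N := lt_trans (by positivity) hN
    exact_mod_cast this
  have hNR : R < N * (δ / 2) := (div_lt_iff₀ (by positivity)).1 hN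
  -- The sign of `C'` is not assumed; a negative value is possible only in the zero space.
  have hC'0 : 0 ≤ C' ∨ ∀ z : V, z = 0 := by
    by_cases h : ∀ z : V, z = 0
    · exact Or.inr h
    · push Not at h
      obtain ⟨z, hz⟩ := h
      obtain ⟨z', -, hz'⟩ := hQ 0 z
      left
      by_contra hneg
      push Not at hneg
      nlinarith [norm_nonneg z', norm_pos_iff.2 hz]
  have hC'K : ∀ z : V, ‖z‖ ≤ K → C' * ‖z‖ ≤ R := by
    intro z hz
    rcases hC'0 with h | h
    · exact (mul_le_mul_of_nonneg_left hz h).trans (le_max_left _ _)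
    · rw [h z, norm_zero, mul_zero]; exact hR0.le
  -- The invariant of the refinement: the number of pieces and the bound `R` on the residual are the
  -- same at all levels; only the frame shrinks.
  have key : ∀ z : V, ‖z‖ ≤ R → ∀ k, ∃ l : List σ, l.length = N ∧ (∀ P ∈ l, P ∈ lev k) ∧
      ∃ z' : V, N • ctr P0 + z = (l.map ctr).sum + Q k z' ∧ ‖z'‖ ≤ R := by
    intro z hz k
    induction k with
    | zero =>
      refine ⟨List.replicate N P0, by simp, fun P hP => ?_, z, by simp [hQ0], hz⟩
      rw [List.eq_of_mem_replicate hP]; exact hP0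
    | succ k ih =>
      obtain ⟨l, hlen, hl, z', hsum, hz'⟩ := ih
      obtain ⟨l', hlen', hl', z'', hsum', hz''⟩ := exists_sweep ctr (Q k) hδ hC (H k) l hl z'
      obtain ⟨z₃, h3, h3n⟩ := hQ k z''
      refine ⟨l', hlen'.trans hlen, hl', z₃, by rw [hsum, hsum', h3], h3n.trans (hC'K _ ?_)⟩
      refine hz''.trans (max_le ?_ le_rfl)
      rw [hlen]; linarith
  refine ⟨N * m, Nat.mul_pos hN0 hm, N • ctr P0, ?_⟩
  rw [mem_interior_iff_mem_nhds]
  refine mem_of_superset (Metric.closedBall_mem_nhds _ hR0) fun y hy => ?_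
  have hcl : IsClosed ((N * m) • E) := (isCompact_nsmul hE _).isClosed
  rw [← hcl.closure_eq, Metric.mem_closure_iff]
  intro ε hε
  have hbound : Tendsto (fun k => N * e k + ‖Q k‖ * R) atTop (𝓝 0) := by
    simpa using (he.const_mul (N : ℝ)).add (hlim.norm.mul_const R)
  obtain ⟨k, hk⟩ := (hbound.eventually (gt_mem_nhds hε)).exists
  obtain ⟨l, hlen, hl, z', hsum, hz'⟩ :=
    key (y - N • ctr P0) (by simpa [dist_eq_norm] using hy) k
  obtain ⟨x, hx, hxe⟩ := list_sum_near (E := E) (m := m) (e := e k) ctr l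
    fun P hP => hreal k P (hl P hP)
  rw [hlen] at hx hxe
  refine ⟨x, hx, lt_of_le_of_lt ?_ hk⟩
  have : y - x = ((l.map ctr).sum - x) + Q k z' := by
    have : y = (l.map ctr).sum + Q k z' := by rw [← hsum]; abel
    rw [this]; abel
  rw [dist_eq_norm, this]
  refine (norm_add_le _ _).trans (add_le_add hxe (((Q k).le_opNorm _).trans ?_))
  gcongr

/-- A finite family not orthogonal to any non-zero vector is uniformly so. -/
theorem exists_pos_le_sum_abs_inner [FiniteDimensional ℝ V] {ι : Type*} [Fintype ι] (x : ι → V)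
    (hx : ∀ y : V, (∀ s, ⟪y, x s⟫_ℝ = 0) → y = 0) :
    ∃ δ > 0, ∀ y : V, δ * ‖y‖ ≤ ∑ s, |⟪y, x s⟫_ℝ| := by
  set f : V → ℝ := fun y => ∑ s, |⟪y, x s⟫_ℝ| with hf
  have hcont : Continuous f := by fun_prop
  rcases (Metric.sphere (0 : V) 1).eq_empty_or_nonempty with h | h
  · refine ⟨1, one_pos, fun y => ?_⟩
    have : y = 0 := by
      by_contra hy
      have : (‖y‖⁻¹ • y) ∈ Metric.sphere (0 : V) 1 := by
        simp [norm_smul, hy]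
      simp [h] at this
    simp [this]
  · obtain ⟨y0, hy0, hmin⟩ := (isCompact_sphere (0 : V) 1).exists_isMinOn h hcont.continuousOn
    have hy1 : ‖y0‖ = 1 := by simpa using hy0
    refine ⟨f y0, ?_, fun y => ?_⟩
    · have h0 : 0 ≤ f y0 := by positivity
      refine lt_of_le_of_ne h0 fun h => ?_
      have : y0 = 0 := hx y0 fun s => by
        have := (Finset.sum_eq_zero_iff_of_nonneg (fun s _ => abs_nonneg _)).1 h.symm s
          (Finset.mem_univ s)
        simpa using this
      simp [this] at hy1
    · by_cases hy : y = 0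
      · simp [hy]
      have hmem : (‖y‖⁻¹ • y) ∈ Metric.sphere (0 : V) 1 := by simp [norm_smul, hy]
      have h1 : f y0 ≤ f (‖y‖⁻¹ • y) := hmin hmem
      have h2 : f (‖y‖⁻¹ • y) = ‖y‖⁻¹ * f y := by
        simp [hf, inner_smul_left, abs_mul, Finset.mul_sum]
      rw [h2] at h1
      have hy' : 0 < ‖y‖ := norm_pos_iff.2 hy
      calc f y0 * ‖y‖ ≤ (‖y‖⁻¹ * f y) * ‖y‖ := by gcongr
        _ = f y := by field_simp

theorem eq_top_of_forall_inner [FiniteDimensional ℝ V] {X : Set V}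
    (hX : ∀ y : V, (∀ x ∈ X, ⟪y, x⟫_ℝ = 0) → y = 0) :
    Submodule.span ℝ X = ⊤ := by
  rw [← Submodule.orthogonal_eq_bot_iff, Submodule.eq_bot_iff]
  exact fun y hy => hX y fun x hx => by
    rw [real_inner_comm]
    exact (Submodule.mem_orthogonal _ _).1 hy x (Submodule.subset_span hx)

theorem eq_zero_of_span_eq_top {X : Set V} (hX : Submodule.span ℝ X = ⊤) {y : V}
    (hy : ∀ x ∈ X, ⟪y, x⟫_ℝ = 0) : y = 0 := by
  have h2 : (Submodule.span ℝ X) ≤ (ℝ ∙ y)ᗮ := by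
    rw [Submodule.span_le]
    exact fun v hv => Submodule.mem_orthogonal_singleton_iff_inner_right.2 (hy v hv)
  rw [hX] at h2
  exact inner_self_eq_zero.1
    (Submodule.mem_orthogonal_singleton_iff_inner_right.1 (h2 (Submodule.mem_top (x := y))))

theorem exists_finset_span [FiniteDimensional ℝ V] {X : Set V} (hX : Submodule.span ℝ X = ⊤) :
    ∃ t : Finset V, (t : Set V) ⊆ X ∧ Submodule.span ℝ (t : Set V) = ⊤ := by
  obtain ⟨t, htX, ht⟩ := Submodule.fg_span_iff_fg_span_finset_subset X |>.1
    (by rw [hX]; exact Module.Finite.fg_top)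
  exact ⟨t, htX, ht ▸ hX⟩

end Greedy

/-! ### Criteria for thickness: scalar frames, frames of powers, commuting linear parts. -/

section Criteria

variable {V : Type*} [NormedAddCommGroup V] [InnerProductSpace ℝ V]

/-- If the `x s` sum to zero, then one of them is at least a fixed fraction of `∑ |x s|`. -/
theorem exists_sum_abs_le_of_sum_eq_zero {ι : Type*} [Fintype ι] [Nonempty ι] (x : ι → ℝ)
    (hx : ∑ s, x s = 0) : ∃ s, ∑ t, |x t| ≤ 2 * Fintype.card ι * x s := by
  obtain ⟨s, -, hs⟩ := Finset.exists_max_image Finset.univ x Finset.univ_nonempty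
  have h0 : 0 ≤ x s := by
    by_contra hneg
    push Not at hneg
    have : ∑ t, x t < ∑ t : ι, (0 : ℝ) :=
      Finset.sum_lt_sum_of_nonempty Finset.univ_nonempty fun t ht => (hs t ht).trans_lt hneg
    simp [hx] at this
  refine ⟨s, ?_⟩
  calc ∑ t, |x t| = ∑ t, (|x t| + x t) := by rw [Finset.sum_add_distrib, hx, add_zero]
    _ ≤ ∑ t : ι, 2 * x s := by
        refine Finset.sum_le_sum fun t ht => ?_
        rcases abs_cases (x t) with ⟨h, -⟩ | ⟨h, -⟩ <;> rw [h] <;> linarith [hs t ht]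
    _ = _ := by simp; ring

/-- Refining a piece along children that do not decrease a linear functional, until its linear part
is of norm about `t`. -/
theorem exists_descend {ι : Type*} [Fintype ι] [Nonempty ι] (F : ι → AffEnd V) {c : V}
    (hc : ∑ s, (F s c - c) = 0) {θ ρ t : ℝ} (hθ : ∀ s, ‖(F s).lin‖ ≤ θ)
    (hρ : ∀ (A : V →L[ℝ] V) s, ρ * ‖A‖ ≤ ‖A * (F s).lin‖) (hρ0 : 0 < ρ) (ζ : V →L[ℝ] ℝ) (n : ℕ) :
    ∀ g : AffEnd V, ρ * t ≤ ‖g.lin‖ → ‖g.lin‖ * θ ^ n ≤ t →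
      ∃ h ∈ Submonoid.closure (Set.range F), ρ * t ≤ ‖(g * h).lin‖ ∧ ‖(g * h).lin‖ ≤ t ∧
        ζ (g c) ≤ ζ ((g * h) c) := by
  have hθ0 : 0 ≤ θ := (norm_nonneg _).trans (hθ (Classical.arbitrary ι))
  induction n with
  | zero => exact fun g h1 h2 => ⟨1, one_mem _, by simpa using h1, by simpa using h2, by simp⟩
  | succ n ih =>
    intro g h1 h2
    by_cases hg : ‖g.lin‖ ≤ t
    · exact ⟨1, one_mem _, by simpa using h1, by simpa using hg, by simp⟩
    push Not at hg
    -- At the barycentre the increments of `ζ` over the children sum to zero, so some child does not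
    -- decrease `ζ`.
    obtain ⟨s, hs⟩ := exists_sum_abs_le_of_sum_eq_zero (fun s => ζ (g.lin (F s c - c)))
      (by rw [← map_sum, ← map_sum, hc, map_zero, map_zero])
    have hs0 : 0 ≤ ζ (g.lin (F s c - c)) := by
      have h3 : 0 ≤ ∑ t, |ζ (g.lin (F t c - c))| := by positivity
      have h4 : (0 : ℝ) < Fintype.card ι := by exact_mod_cast Fintype.card_pos
      by_contra hneg
      push Not at hneg
      nlinarith
    obtain ⟨h, hh, h5, h6, h7⟩ := ih (g * F s)
      (by rw [AffEnd.mul_lin]; exact (by gcongr : ρ * t ≤ ρ * ‖g.lin‖).trans (hρ _ _)) (by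
        rw [AffEnd.mul_lin]
        calc ‖g.lin * (F s).lin‖ * θ ^ n ≤ (‖g.lin‖ * θ) * θ ^ n := by
              gcongr
              exact (norm_mul_le _ _).trans (by gcongr; exact hθ s)
          _ = ‖g.lin‖ * θ ^ (n + 1) := by ring
          _ ≤ t := h2)
    refine ⟨F s * h, mul_mem (Submonoid.subset_closure ⟨s, rfl⟩) hh, by rwa [← mul_assoc],
      by rwa [← mul_assoc], ?_⟩
    rw [← mul_assoc]
    refine le_trans ?_ h7
    rw [AffEnd.mul_apply, AffEnd.apply_eq_apply_add g (F s c) c, map_add]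
    linarith

theorem finset_sum_mem_nsmul {W : Type*} [AddCommGroup W] {E : Set W} {κ : Type*} [Fintype κ]
    (x : κ → W) (hx : ∀ j, x j ∈ E) : ∑ j, x j ∈ Fintype.card κ • E := by
  have := Set.finsetSum_mem_finsetSum Finset.univ (fun _ : κ => E) x fun j _ => hx j
  simpa using this

/-- Properties of the elements of the monoid generated by contractions that map `E` to itself. -/
theorem closure_bound {ι : Type*} {E : Set V} (hE : IsCompact E) (hne : E.Nonempty)
    (F : ι → AffEnd V) (hFE : ∀ s, ∀ x ∈ E, F s x ∈ E) (hF : ∀ s, ‖(F s).lin‖ ≤ 1) (c : V) :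
    ∃ C > 0, ∀ h ∈ Submonoid.closure (Set.range F),
      ‖h.lin‖ ≤ 1 ∧ (∀ x ∈ E, h x ∈ E) ∧ ‖h c - c‖ ≤ C := by
  obtain ⟨e, he⟩ := hne
  obtain ⟨R, hR⟩ := hE.isBounded.subset_closedBall c
  refine ⟨‖c - e‖ + |R| + 1, by positivity, fun h hh => ?_⟩
  have key : ‖h.lin‖ ≤ 1 ∧ ∀ x ∈ E, h x ∈ E := by
    induction hh using Submonoid.closure_induction with
    | mem g hg => obtain ⟨s, rfl⟩ := hg; exact ⟨hF s, hFE s⟩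
    | one => exact ⟨ContinuousLinearMap.norm_id_le, fun x hx => by rwa [AffEnd.one_apply]⟩
    | mul f g _ _ hf hg =>
      refine ⟨?_, fun x hx => by rw [AffEnd.mul_apply]; exact hf.2 _ (hg.2 x hx)⟩
      rw [AffEnd.mul_lin]
      exact (norm_mul_le _ _).trans (mul_le_one₀ hf.1 (norm_nonneg _) hg.1)
  refine ⟨key.1, key.2, ?_⟩
  have h1 : ‖h c - h e‖ ≤ ‖c - e‖ := by
    rw [AffEnd.apply_sub_apply]
    exact (h.lin.le_opNorm _).trans (mul_le_of_le_one_left (norm_nonneg _) key.1)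
  have h2 : ‖h e - c‖ ≤ |R| := by
    have := hR (key.2 e he)
    rw [Metric.mem_closedBall, dist_eq_norm] at this
    exact this.trans (le_abs_self R)
  calc ‖h c - c‖ = ‖(h c - h e) + (h e - c)‖ := by congr 1; abel
    _ ≤ _ := by linarith [norm_add_le (h c - h e) (h e - c)]

/-- Thickness from a family of contractions all of whose products are, at their own scale, uniformly
non-degenerate. -/
theorem thick_of_scale [Nontrivial V] {ι κ : Type*} [Fintype ι] [Nonempty ι] [Fintype κ]
    [Nonempty κ] {E : Set V} (hE : IsCompact E) (hne : E.Nonempty)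
    (F : ι → AffEnd V) (hFE : ∀ s, ∀ x ∈ E, F s x ∈ E) {θ : ℝ} (hθ1 : θ < 1)
    (hθ : ∀ s, ‖(F s).lin‖ ≤ θ) (hU : ∀ s, IsUnit (F s).lin)
    (B : κ → AffEnd V) (hB : ∀ j, ∀ x ∈ E, B j x ∈ E)
    (P : Set (V →L[ℝ] V)) (h1P : 1 ∈ P) (hP : ∀ A ∈ P, ∀ s, A * (F s).lin ∈ P)
    {c : V} (hc : ∑ s, (F s c - c) = 0) {δ : ℝ} (hδ : 0 < δ)
    (hstar : ∀ A : κ → V →L[ℝ] V, (∀ j, A j ∈ P) → ∀ y : V,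
      δ * ‖y‖ ≤ ∑ j, ‖A j‖⁻¹ * ∑ s, |⟪y, (B j).lin (A j (F s c - c))⟫_ℝ|) :
    ∃ n : ℕ, 1 ≤ n ∧ (interior (n • E)).Nonempty := by
  classical
  have hθ0 : 0 ≤ θ := (norm_nonneg _).trans (hθ (Classical.arbitrary ι))
  -- One more factor `F s` shrinks a norm by no more than `ρ = J⁻¹`, so a descent cannot jump over a
  -- window `[ρ ^ (k + 1), ρ ^ k]`. The summand `2` ensures `ρ < 1`.
  set J : ℝ := 2 + ∑ s, ‖Ring.inverse (F s).lin‖ with hJ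
  have hJ2 : 2 ≤ J := by
    have : 0 ≤ ∑ s, ‖Ring.inverse (F s).lin‖ := by positivity
    linarith
  set ρ : ℝ := J⁻¹ with hρdef
  have hρ0 : 0 < ρ := by positivity
  have hρ1 : ρ < 1 := inv_lt_one_of_one_lt₀ (by linarith)
  have hρ : ∀ (A : V →L[ℝ] V) s, ρ * ‖A‖ ≤ ‖A * (F s).lin‖ := by
    intro A s
    have h1 : ‖Ring.inverse (F s).lin‖ ≤ J := by
      have := Finset.single_le_sum (f := fun s => ‖Ring.inverse (F s).lin‖)
        (fun _ _ => norm_nonneg _) (Finset.mem_univ s)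
      linarith
    have h2 : ‖A‖ ≤ ‖A * (F s).lin‖ * J := by
      calc ‖A‖ = ‖A * (F s).lin * Ring.inverse (F s).lin‖ := by
            rw [mul_assoc, Ring.mul_inverse_cancel _ (hU s), mul_one]
        _ ≤ _ := (norm_mul_le _ _).trans (by gcongr)
    rw [hρdef, inv_mul_le_iff₀ (by positivity), mul_comm]
    exact h2
  obtain ⟨C0, hC0, hcl⟩ := closure_bound hE hne F hFE (fun s => (hθ s).trans hθ1.le) c
  obtain ⟨e0, he0⟩ := hne
  set S := Submonoid.closure (Set.range F)
  have hPS : ∀ h ∈ S, ∀ A ∈ P, A * h.lin ∈ P := by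
    intro h hh
    induction hh using Submonoid.closure_induction with
    | mem g hg => obtain ⟨s, rfl⟩ := hg; exact fun A hA => hP A hA s
    | one => intro A hA; simpa using hA
    | mul f g _ _ hf hg =>
      intro A hA
      rw [AffEnd.mul_lin, ← mul_assoc]; exact hg _ (hf _ hA)
  set n : ℝ := (Fintype.card ι : ℝ) with hn
  have hn0 : 0 < n := by simp [hn, Fintype.card_pos]
  -- A piece is a tuple of products of comparable size. A single `B j` may miss some directions `y`;
  -- the tuple as a whole sees all of them.
  set lev : ℕ → Set (κ → AffEnd V) := fun k =>
    {g | ∀ j, g j ∈ S ∧ (g j).lin ∈ P ∧ ρ ^ (k + 1) ≤ ‖(g j).lin‖ ∧ ‖(g j).lin‖ ≤ ρ ^ k}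
  set ctr : (κ → AffEnd V) → V := fun g => ∑ j, B j (g j c)
  set Cb : ℝ := ∑ j, ‖(B j).lin‖ with hCb
  have hCb0 : 0 ≤ Cb := by positivity
  -- The factor `1 / (2 * n)` is the share of the largest of `n` increments summing to zero; `ρ` is
  -- the width of the norm window.
  set δ' : ℝ := ρ * δ / (2 * n) with hδ'
  have hδ'0 : 0 < δ' := by positivity
  refine exists_interior_of_refinement (σ := κ → AffEnd V) hE (m := Fintype.card κ)
    Fintype.card_pos lev ctr (fun k => (ρ ^ k) • (1 : V →L[ℝ] V)) (δ := δ') (C := δ' + Cb * C0)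
    (C' := J) hδ'0 (by nlinarith [mul_nonneg hCb0 hC0.le])
    ?_ (by simp) ?_ ?_ ?_ (fun k => ρ ^ k * (Cb * ‖c - e0‖)) ?_ ?_
  · refine ⟨fun _ => 1, fun j => ⟨one_mem _, by simpa using h1P, ?_, ?_⟩⟩
    · simpa using hρ1.le
    · simp
  · intro k z
    refine ⟨J • z, ?_, ?_⟩
    · simp only [smul_apply, one_apply_eq_self, smul_smul, pow_succ,
        hρdef]
      rw [mul_assoc, inv_mul_cancel₀ (by positivity), mul_one]
    · rw [norm_smul, Real.norm_of_nonneg (by linarith)]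
  · have := (tendsto_pow_atTop_nhds_zero_of_lt_one hρ0.le hρ1).smul_const (1 : V →L[ℝ] V)
    simpa using this
  · intro k g hg z
    have hρk : 0 < ρ ^ k := by positivity
    -- The first child secures the gain; the descent below it reaches the next norm window without
    -- losing that gain.
    have step : ∀ j, ∃ h ∈ S, ρ ^ (k + 2) ≤ ‖(g j * h).lin‖ ∧ ‖(g j * h).lin‖ ≤ ρ ^ (k + 1) ∧
        ∑ s, |⟪z, (B j).lin ((g j).lin (F s c - c))⟫_ℝ| ≤
          2 * n * ⟪z, (B j).lin ((g j).lin (h c - c))⟫_ℝ := by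
      intro j
      set ζ : V →L[ℝ] ℝ := (innerSL ℝ z).comp (B j).lin with hζ
      obtain ⟨s, hs⟩ := exists_sum_abs_le_of_sum_eq_zero (fun s => ζ ((g j).lin (F s c - c)))
        (by rw [← map_sum, ← map_sum, hc, map_zero, map_zero])
      have hnorm : ‖(g j * F s).lin‖ ≤ 1 := by
        refine (hcl _ (mul_mem (hg j).1 (Submonoid.subset_closure ⟨s, rfl⟩))).1
      obtain ⟨N, hN⟩ := exists_pow_lt_of_lt_one (show 0 < ρ ^ (k + 1) by positivity) hθ1
      obtain ⟨h, hh, h1, h2, h3⟩ := exists_descend F hc hθ hρ hρ0 ζ N (t := ρ ^ (k + 1)) (g j * F s)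
        (by
          rw [AffEnd.mul_lin]
          exact (by gcongr; exact (hg j).2.2.1 : ρ * ρ ^ (k + 1) ≤ ρ * ‖(g j).lin‖).trans (hρ _ _))
        (by
          have : ‖(g j * F s).lin‖ * θ ^ N ≤ 1 * θ ^ N := by gcongr
          linarith)
      refine ⟨F s * h, mul_mem (Submonoid.subset_closure ⟨s, rfl⟩) hh, ?_, ?_, ?_⟩
      · rw [← mul_assoc]; convert h1 using 1; ring
      · rwa [← mul_assoc]
      · refine hs.trans ?_
        have e1 : ζ ((g j).lin (F s c - c)) = ζ ((g j * F s) c) - ζ (g j c) := by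
          rw [AffEnd.mul_apply, ← map_sub, AffEnd.apply_sub_apply]
        have e2 : ⟪z, (B j).lin ((g j).lin ((F s * h) c - c))⟫_ℝ
            = ζ ((g j * F s * h) c) - ζ (g j c) := by
          rw [mul_assoc, AffEnd.mul_apply (g j), ← map_sub, AffEnd.apply_sub_apply]; rfl
        rw [e1, e2]
        gcongr
    choose h hS hlow hup hgain using step
    refine ⟨fun j => g j * h j, fun j => ⟨mul_mem (hg j).1 (hS j), ?_, hlow j, hup j⟩,
      (ρ ^ k)⁻¹ • ∑ j, (B j).lin ((g j).lin (h j c - c)), ?_, ?_, ?_⟩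
    · rw [AffEnd.mul_lin]; exact hPS _ (hS j) _ (hg j).2.1
    · simp only [ctr, ← Finset.sum_sub_distrib, smul_apply,
        one_apply_eq_self, smul_smul, mul_inv_cancel₀ hρk.ne', one_smul]
      refine Finset.sum_congr rfl fun j _ => ?_
      rw [AffEnd.mul_apply, AffEnd.apply_sub_apply, AffEnd.apply_sub_apply]
    · have h1 := hstar (fun j => (g j).lin) (fun j => (hg j).2.1) z
      have h2 : ∑ j, ‖(g j).lin‖⁻¹ * ∑ s, |⟪z, (B j).lin ((g j).lin (F s c - c))⟫_ℝ| ≤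
          ∑ j, (ρ ^ (k + 1))⁻¹ * (2 * n * ⟪z, (B j).lin ((g j).lin (h j c - c))⟫_ℝ) := by
        refine Finset.sum_le_sum fun j _ => ?_
        gcongr
        · exact (hg j).2.2.1
        · exact hgain j
      rw [inner_smul_right, inner_sum]
      rw [← Finset.mul_sum, ← Finset.mul_sum] at h2
      have h3 := h1.trans h2
      set G := ∑ j, ⟪z, (B j).lin ((g j).lin (h j c - c))⟫_ℝ
      calc δ' * ‖z‖ = ρ / (2 * n) * (δ * ‖z‖) := by rw [hδ']; ring
        _ ≤ ρ / (2 * n) * ((ρ ^ (k + 1))⁻¹ * (2 * n * G)) := by gcongr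
        _ = (ρ ^ k)⁻¹ * G := by rw [pow_succ]; field_simp
    · have h1 : ‖∑ j, (B j).lin ((g j).lin (h j c - c))‖ ≤ ρ ^ k * (Cb * C0) := by
        calc _ ≤ ∑ j, ‖(B j).lin‖ * (ρ ^ k * C0) := by
              refine norm_sum_le_of_le _ fun j _ => ((B j).lin.le_opNorm _).trans ?_
              gcongr
              refine ((g j).lin.le_opNorm _).trans ?_
              gcongr
              · exact (hg j).2.2.2
              · exact (hcl _ (hS j)).2.2
          _ = _ := by rw [← Finset.sum_mul]; ring
      rw [norm_smul, norm_inv, Real.norm_of_nonneg hρk.le, inv_mul_le_iff₀ hρk]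
      refine h1.trans ?_
      gcongr
      linarith
  · simpa using (tendsto_pow_atTop_nhds_zero_of_lt_one hρ0.le hρ1).mul_const (Cb * ‖c - e0‖)
  · intro k g hg
    refine ⟨∑ j, B j (g j e0), finset_sum_mem_nsmul _ fun j =>
      hB j _ ((hcl _ (hg j).1).2.1 _ he0), ?_⟩
    simp only [ctr, ← Finset.sum_sub_distrib]
    calc _ ≤ ∑ j, ‖(B j).lin‖ * (ρ ^ k * ‖c - e0‖) := by
          refine norm_sum_le_of_le _ fun j _ => ?_
          rw [AffEnd.apply_sub_apply, AffEnd.apply_sub_apply]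
          refine ((B j).lin.le_opNorm _).trans ?_
          gcongr
          refine ((g j).lin.le_opNorm _).trans ?_
          gcongr
          exact (hg j).2.2.2
      _ = _ := by rw [← Finset.sum_mul]; ring

/-- Thickness from a family of contractions whose `k`-fold products are uniformly comparable to the
powers of a single contraction `D`. -/
theorem thick_of_frame {ι : Type*} [Fintype ι] [Nonempty ι]
    {E : Set V} (hE : IsCompact E) (hne : E.Nonempty)
    (F : ι → AffEnd V) (hFE : ∀ s, ∀ x ∈ E, F s x ∈ E)
    (D : V →L[ℝ] V) (hD1 : ‖D‖ < 1) (hDU : IsUnit D)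
    (lev : ℕ → Set (V →L[ℝ] V)) (h1 : 1 ∈ lev 0)
    (hlev : ∀ k, ∀ A ∈ lev k, ∀ s, A * (F s).lin ∈ lev (k + 1))
    {c : V} (hc : ∑ s, (F s c - c) = 0) {δ C : ℝ} (hδ : 0 < δ)
    (hstar : ∀ k, ∀ A ∈ lev k, ∃ U : V →L[ℝ] V, A = D ^ k * U ∧ ‖U‖ ≤ C ∧
      ∀ y : V, δ * ‖y‖ ≤ ∑ s, |⟪y, U (F s c - c)⟫_ℝ|) :
    ∃ n : ℕ, 1 ≤ n ∧ (interior (n • E)).Nonempty := by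
  obtain ⟨e0, he0⟩ := hne
  set n : ℝ := (Fintype.card ι : ℝ) with hn
  have hn0 : 0 < n := by simp [hn, Fintype.card_pos]
  set C1 : ℝ := ∑ s, ‖F s c - c‖ with hC1
  have hC0 : 0 ≤ C := by
    obtain ⟨U, -, hU, -⟩ := hstar 0 1 h1
    exact (norm_nonneg _).trans hU
  set δ' : ℝ := δ / (2 * n) with hδ'
  have hDpow := tendsto_pow_atTop_nhds_zero_of_norm_lt_one hD1
  -- In the frame `D ^ k` a piece with linear part `D ^ k * U` is displaced by `U (F s c - c)`, so
  -- only the bounded factor `U` matters, however distorted `D ^ k` is. A change of frame costs the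
  -- norm of the inverse of `D`.
  refine exists_interior_of_refinement (σ := AffEnd V) hE (m := 1) le_rfl
    (fun k => {g | g.lin ∈ lev k ∧ ∀ x ∈ E, g x ∈ E}) (fun g => g c) (fun k => D ^ k) (δ := δ')
    (C := δ' + C * C1) (C' := ‖Ring.inverse D‖) (by positivity) ?_ ?_ (by simp) ?_ hDpow ?_
    (fun k => ‖D ^ k‖ * (C * ‖c - e0‖)) ?_ ?_
  · have : 0 ≤ C * C1 := by positivity
    linarith
  · exact ⟨1, by simpa using h1, fun x hx => by rwa [AffEnd.one_apply]⟩
  · intro k z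
    refine ⟨Ring.inverse D z, ?_, ContinuousLinearMap.le_opNorm _ _⟩
    rw [pow_succ, mul_apply_eq_comp, ← mul_apply_eq_comp D, Ring.mul_inverse_cancel _ hDU]; rfl
  · rintro k g ⟨hg, hgE⟩ z
    obtain ⟨U, hgU, hUC, hU⟩ := hstar k _ hg
    obtain ⟨s, hs⟩ := exists_sum_abs_le_of_sum_eq_zero (fun s => ⟪z, U (F s c - c)⟫_ℝ)
        (by rw [← inner_sum, ← map_sum, hc, map_zero, inner_zero_right])
    refine ⟨g * F s, ⟨hlev k _ hg s, fun x hx => ?_⟩, U (F s c - c), ?_, ?_, ?_⟩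
    · rw [AffEnd.mul_apply]; exact hgE _ (hFE s x hx)
    · rw [AffEnd.mul_apply, AffEnd.apply_sub_apply, hgU]; rfl
    · rw [hδ', div_mul_eq_mul_div, div_le_iff₀ (by positivity), mul_comm _ (2 * n)]
      exact (hU z).trans hs
    · have h2 : ‖F s c - c‖ ≤ C1 := Finset.single_le_sum (f := fun s => ‖F s c - c‖)
        (fun _ _ => norm_nonneg _) (Finset.mem_univ s)
      have h3 : ‖U (F s c - c)‖ ≤ C * C1 := (U.le_opNorm _).trans (by gcongr)
      have : 0 < δ' := by positivity
      linarith
  · simpa using hDpow.norm.mul_const (C * ‖c - e0‖)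
  · rintro k g ⟨hg, hgE⟩
    refine ⟨g e0, by simpa using hgE e0 he0, ?_⟩
    obtain ⟨U, hgU, hUC, -⟩ := hstar k _ hg
    rw [AffEnd.apply_sub_apply, hgU, mul_apply_eq_comp]
    refine ((D ^ k).le_opNorm _).trans ?_
    gcongr
    exact (U.le_opNorm _).trans (by gcongr)

/-- Thickness from pairs of maps with equal linear parts, when all linear parts commute and the
differences of the pairs span. -/
theorem thick_of_commuting [FiniteDimensional ℝ V] {E : Set V} (hE : IsCompact E)
    (hne : E.Nonempty) (S : Submonoid (AffEnd V)) (hSE : ∀ g ∈ S, ∀ x ∈ E, g x ∈ E)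
    (hS1 : ∀ g ∈ S, ‖g.lin‖ ≤ 1) (hSU : ∀ g ∈ S, IsUnit g.lin)
    (hcomm : ∀ g ∈ S, ∀ h ∈ S, g.lin * h.lin = h.lin * g.lin)
    {g₀ : AffEnd V} (hg₀ : g₀ ∈ S) (hg₀1 : ‖g₀.lin‖ < 1)
    (hspan : Submodule.span ℝ {v : V | ∃ f ∈ S, ∃ f' ∈ S, f.lin = f'.lin ∧ f.tr - f'.tr = v} = ⊤) :
    ∃ n : ℕ, 1 ≤ n ∧ (interior (n • E)).Nonempty := by
  classical
  set X := {v : V | ∃ f ∈ S, ∃ f' ∈ S, f.lin = f'.lin ∧ f.tr - f'.tr = v} with hX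
  obtain ⟨t, htX, ht⟩ := exists_finset_span hspan
  -- Composing both members of a pair on the right with the same map preserves the difference of
  -- their translations. Since linear parts commute, all pairs can be given one common linear part
  -- in this way.
  have main : ∀ t : Finset V, (t : Set V) ⊆ X → ∃ h ∈ S, ‖h.lin‖ < 1 ∧ ∀ v ∈ t, ∃ f ∈ S, ∃ f' ∈ S,
      f.lin = h.lin ∧ f'.lin = h.lin ∧ f.tr - f'.tr = v := by
    intro t
    induction t using Finset.induction_on with
    | empty => exact fun _ => ⟨g₀, hg₀, hg₀1, by simp⟩
    | insert v t hv ih =>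
      intro htX
      obtain ⟨h, hh, hh1, hall⟩ := ih fun x hx => htX (by simp [Finset.mem_coe.1 hx])
      obtain ⟨g, hg, g', hg', hgg, hdiff⟩ :=
        htX (show v ∈ ((insert v t : Finset V) : Set V) by simp)
      refine ⟨h * g, mul_mem hh hg, ?_, fun w hw => ?_⟩
      · rw [AffEnd.mul_lin]
        refine (norm_mul_le _ _).trans_lt ?_
        exact (mul_le_of_le_one_right (norm_nonneg _) (hS1 g hg)).trans_lt hh1
      · rcases Finset.mem_insert.1 hw with rfl | hw
        · refine ⟨g * h, mul_mem hg hh, g' * h, mul_mem hg' hh, ?_, ?_, ?_⟩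
          · exact hcomm g hg h hh
          · rw [AffEnd.mul_lin, ← hgg]; exact hcomm g hg h hh
          · simp only [AffEnd.mul_tr, ← hgg]; rw [← hdiff]; abel
        · obtain ⟨f, hf, f', hf', e1, e2, e3⟩ := hall w hw
          refine ⟨f * g, mul_mem hf hg, f' * g, mul_mem hf' hg, by simp [e1], by simp [e2], ?_⟩
          simp only [AffEnd.mul_tr, e1, e2]; rw [← e3]; abel
  obtain ⟨h, hh, hh1, hall⟩ := main t htX
  choose f hf f' hf' e1 e2 e3 using fun v : t => hall v.1 v.2
  -- The index `none` keeps the family non-empty even when `t` is empty. As linear parts agree, the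
  -- differences of values at `c` are those of the translations, for any `c`.
  set F : Option (t × Bool) → AffEnd V := fun s => match s with
    | none => h
    | some (v, true) => f v
    | some (v, false) => f' v
  have hFS : ∀ s, F s ∈ S := by
    rintro (_ | ⟨v, _ | _⟩)
    exacts [hh, hf' v, hf v]
  have hFl : ∀ s, (F s).lin = h.lin := by
    rintro (_ | ⟨v, _ | _⟩)
    exacts [rfl, e2 v, e1 v]
  obtain ⟨c, hc⟩ := AffEnd.exists_barycentre F hh1 fun s => (congrArg norm (hFl s)).le
  obtain ⟨δ, hδ, hδ'⟩ := exists_pos_le_sum_abs_inner (fun s => F s c - c) (by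
    intro y hy
    have h1 : ∀ v ∈ t, ⟪y, v⟫_ℝ = 0 := by
      intro v hv
      have e4 : (f ⟨v, hv⟩ c - c) - (f' ⟨v, hv⟩ c - c) = v := by
        rw [AffEnd.apply_def, AffEnd.apply_def, e1, e2]
        refine Eq.trans ?_ (e3 ⟨v, hv⟩)
        abel
      have e5 : ⟪y, f ⟨v, hv⟩ c - c⟫_ℝ = 0 := hy (some (⟨v, hv⟩, true))
      have e6 : ⟪y, f' ⟨v, hv⟩ c - c⟫_ℝ = 0 := hy (some (⟨v, hv⟩, false))
      have e7 := congrArg (fun x => ⟪y, x⟫_ℝ) e4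
      simp only [inner_sub_right] at e7 e5 e6
      rw [← e7, e5, e6, sub_zero]
    exact eq_zero_of_span_eq_top ht h1)
  refine thick_of_frame hE hne F (fun s => hSE _ (hFS s)) h.lin hh1 (hSU h hh)
    (fun k => {h.lin ^ k}) (by simp) ?_ hc (δ := δ) (C := ‖(1 : V →L[ℝ] V)‖) hδ ?_
  · intro k A hA s
    rw [Set.mem_singleton_iff] at hA ⊢
    rw [hA, hFl, pow_succ]
  · intro k A hA
    exact ⟨1, by simpa using hA, le_rfl, fun y => by simpa using hδ' y⟩

end Criteria

/-! ### Attractors not contained in a hyperplane; the commuting case. -/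

section System

variable {V : Type*} [NormedAddCommGroup V] [InnerProductSpace ℝ V]

/-- `E` is the attractor of the finite system `φ` of invertible affine contractions, and is not
contained in a hyperplane. -/
structure IsSystem {ι : Type*} (φ : ι → AffEnd V) (E : Set V) : Prop where
  isUnit : ∀ i, IsUnit (φ i).lin
  contr : ∃ c : ℝ, 0 < c ∧ c < 1 ∧ ∀ i, ‖(φ i).lin‖ ≤ c
  compact : IsCompact E
  nonempty : E.Nonempty
  eq_iUnion : E = ⋃ i, (φ i) '' E
  not_subset : ∀ v : V, v ≠ 0 → ∀ b : ℝ, ¬ E ⊆ {x | ⟪v, x⟫_ℝ = b}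

/-- The monoid generated by the maps of a system. -/
def monoid {ι : Type*} (φ : ι → AffEnd V) : Submonoid (AffEnd V) := Submonoid.closure (Set.range φ)

namespace IsSystem

variable {ι : Type*} {φ : ι → AffEnd V} {E : Set V}

theorem mem_monoid (i : ι) : φ i ∈ monoid φ := Submonoid.subset_closure ⟨i, rfl⟩

theorem mapsTo_gen (h : IsSystem φ E) (i : ι) : ∀ x ∈ E, φ i x ∈ E := fun x hx => by
  rw [h.eq_iUnion]; exact Set.mem_iUnion.2 ⟨i, x, hx, rfl⟩

theorem norm_gen_lt (h : IsSystem φ E) (i : ι) : ‖(φ i).lin‖ < 1 := by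
  obtain ⟨c, -, hc1, hc⟩ := h.contr
  exact (hc i).trans_lt hc1

theorem orbit_bound (h : IsSystem φ E) (p : V) : ∃ C > 0, ∀ g ∈ monoid φ,
    ‖g.lin‖ ≤ 1 ∧ (∀ x ∈ E, g x ∈ E) ∧ ‖g p - p‖ ≤ C :=
  closure_bound h.compact h.nonempty φ h.mapsTo_gen (fun i => (h.norm_gen_lt i).le) p

theorem mapsTo (h : IsSystem φ E) {g : AffEnd V} (hg : g ∈ monoid φ) : ∀ x ∈ E, g x ∈ E := by
  obtain ⟨C, -, hC⟩ := h.orbit_bound 0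
  exact (hC g hg).2.1

theorem norm_le_one (h : IsSystem φ E) {g : AffEnd V} (hg : g ∈ monoid φ) : ‖g.lin‖ ≤ 1 := by
  obtain ⟨C, -, hC⟩ := h.orbit_bound 0
  exact (hC g hg).1

theorem isUnit_lin (h : IsSystem φ E) {g : AffEnd V} (hg : g ∈ monoid φ) : IsUnit g.lin := by
  induction hg using Submonoid.closure_induction with
  | mem g hg => obtain ⟨i, rfl⟩ := hg; exact h.isUnit i
  | one => simp
  | mul f g _ _ hf hg => rw [AffEnd.mul_lin]; exact hf.mul hg

theorem index_nonempty (h : IsSystem φ E) : Nonempty ι := by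
  obtain ⟨x, hx⟩ := h.nonempty
  rw [h.eq_iUnion] at hx
  obtain ⟨i, -⟩ := Set.mem_iUnion.1 hx
  exact ⟨i⟩

/-- Iterating `E = ⋃ i, φ i '' E` puts each point into arbitrarily contracted pieces, which is what
makes the orbit of any base point approach `E`. -/
theorem exists_deep (h : IsSystem φ E) {c : ℝ} (hc : ∀ i, ‖(φ i).lin‖ ≤ c) (n : ℕ) :
    ∀ e ∈ E, ∃ g ∈ monoid φ, ∃ x ∈ E, g x = e ∧ ‖g.lin‖ ≤ c ^ n := by
  have hc0 : 0 ≤ c := (norm_nonneg _).trans (hc (Classical.choice h.index_nonempty))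
  induction n with
  | zero =>
    exact fun e he => ⟨1, one_mem _, e, he, AffEnd.one_apply e, by
      rw [pow_zero]; exact ContinuousLinearMap.norm_id_le⟩
  | succ n ih =>
    intro e he
    rw [h.eq_iUnion] at he
    obtain ⟨i, x, hx, rfl⟩ := Set.mem_iUnion.1 he
    obtain ⟨g, hg, y, hy, rfl, hn⟩ := ih x hx
    refine ⟨φ i * g, mul_mem (mem_monoid i) hg, y, hy, AffEnd.mul_apply _ _ _, ?_⟩
    rw [AffEnd.mul_lin, pow_succ, mul_comm (c ^ n)]
    exact (norm_mul_le _ _).trans (by gcongr; exact hc i)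

/-- Orbits of the monoid accumulate everywhere on the attractor. -/
theorem mem_closure_orbit (h : IsSystem φ E) (p : V) {e : V} (he : e ∈ E) :
    e ∈ closure {x | ∃ g ∈ monoid φ, g p = x} := by
  obtain ⟨c, hc0, hc1, hc⟩ := h.contr
  obtain ⟨R, hR⟩ := h.compact.isBounded.subset_closedBall p
  rw [Metric.mem_closure_iff]
  intro ε hε
  have hlim : Tendsto (fun n : ℕ => c ^ n * R) atTop (𝓝 0) := by
    simpa using (tendsto_pow_atTop_nhds_zero_of_lt_one hc0.le hc1).mul_const R
  obtain ⟨n, hn⟩ := (hlim.eventually (gt_mem_nhds hε)).exists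
  obtain ⟨g, hg, x, hx, rfl, hgn⟩ := h.exists_deep hc n e he
  refine ⟨g p, ⟨g, hg, rfl⟩, lt_of_le_of_lt ?_ hn⟩
  rw [dist_eq_norm, AffEnd.apply_sub_apply]
  refine (g.lin.le_opNorm _).trans ?_
  have := hR hx
  rw [Metric.mem_closedBall, dist_eq_norm] at this
  gcongr

/-- A functional constant on the orbit is constant on its closure, hence on `E`. The hypothesis that
`E` lies in no hyperplane enters the proof through this lemma alone. -/
theorem exists_inner_ne (h : IsSystem φ E) (p : V) {y : V} (hy : y ≠ 0) :
    ∃ g ∈ monoid φ, ⟪y, g p⟫_ℝ ≠ ⟪y, p⟫_ℝ := by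
  by_contra hcon
  push Not at hcon
  refine h.not_subset y hy ⟪y, p⟫_ℝ fun e he => ?_
  have hcl : IsClosed {x : V | ⟪y, x⟫_ℝ = ⟪y, p⟫_ℝ} :=
    isClosed_eq (by fun_prop) continuous_const
  refine hcl.closure_subset_iff.2 ?_ (h.mem_closure_orbit p he)
  rintro x ⟨g, hg, rfl⟩
  exact hcon g hg

variable [FiniteDimensional ℝ V]

theorem span_orbit (h : IsSystem φ E) (p : V) :
    Submodule.span ℝ {x : V | ∃ g ∈ monoid φ, g p - p = x} = ⊤ := by
  refine eq_top_of_forall_inner fun y hy => ?_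
  by_contra hy0
  obtain ⟨g, hg, hne⟩ := h.exists_inner_ne p hy0
  have := hy _ ⟨g, hg, rfl⟩
  rw [inner_sub_right, sub_eq_zero] at this
  exact hne this

/-- Thickness of attractors of systems with commuting linear parts. -/
theorem thick_of_comm (h : IsSystem φ E)
    (hcomm : ∀ i j, (φ i).lin * (φ j).lin = (φ j).lin * (φ i).lin) :
    ∃ n : ℕ, 1 ≤ n ∧ (interior (n • E)).Nonempty := by
  have hc1 : ∀ g ∈ monoid φ, ∀ i, Commute g.lin (φ i).lin := by
    intro g hg i
    induction hg using Submonoid.closure_induction with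
    | mem g hg => obtain ⟨j, rfl⟩ := hg; exact hcomm j i
    | one => exact Commute.one_left _
    | mul f g _ _ hf hg => rw [AffEnd.mul_lin]; exact hf.mul_left hg
  have hc2 : ∀ g ∈ monoid φ, ∀ f ∈ monoid φ, Commute g.lin f.lin := by
    intro g hg f hf
    induction hf using Submonoid.closure_induction with
    | mem f hf => obtain ⟨j, rfl⟩ := hf; exact hc1 g hg j
    | one => exact Commute.one_right _
    | mul f g _ _ hf hg => rw [AffEnd.mul_lin]; exact hf.mul_right hg
  obtain ⟨i⟩ := h.index_nonempty
  obtain ⟨p, hp⟩ := AffEnd.exists_fixed (φ i) (h.norm_gen_lt i)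
  refine thick_of_commuting h.compact h.nonempty (monoid φ) (fun g hg => h.mapsTo hg)
    (fun g hg => h.norm_le_one hg) (fun g hg => h.isUnit_lin hg) (fun g hg f hf => hc2 g hg f hf)
    (mem_monoid i) (h.norm_gen_lt i) ?_
  -- The maps `g * φ i` and `φ i * g` have equal linear parts and differ at the fixed point `p` by
  -- `(1 - (φ i).lin) (g p - p)`. The vectors `g p - p` span, and `1 - (φ i).lin` is invertible.
  obtain ⟨U, hU⟩ := isUnit_one_sub_of_norm_lt_one (h.norm_gen_lt i)
  rw [eq_top_iff]
  intro x _
  have hx : (↑U⁻¹ : V →L[ℝ] V) x ∈ Submodule.span ℝ {x : V | ∃ g ∈ monoid φ, g p - p = x} := by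
    rw [h.span_orbit p]; trivial
  have hx' : x = ((1 : V →L[ℝ] V) - (φ i).lin) ((↑U⁻¹ : V →L[ℝ] V) x) := by
    rw [← hU, ← mul_apply_eq_comp, Units.mul_inv]; rfl
  rw [hx']
  have := Submodule.mem_map_of_mem (f := ((1 : V →L[ℝ] V) - (φ i).lin).toLinearMap) hx
  rw [Submodule.map_span] at this
  refine Submodule.span_mono ?_ this
  rintro _ ⟨_, ⟨g, hg, rfl⟩, rfl⟩
  have hlin : (g * φ i).lin = (φ i * g).lin := hc1 g hg i
  refine ⟨g * φ i, mul_mem hg (mem_monoid i), φ i * g, mul_mem (mem_monoid i) hg, hlin, ?_⟩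
  have e1 : (g * φ i).tr - (φ i * g).tr = (g * φ i) p - (φ i * g) p := by
    rw [AffEnd.apply_def, AffEnd.apply_def, hlin]; abel
  have e2 : φ i (g p) = p + (φ i).lin (g p - p) := by
    conv_lhs => rw [AffEnd.apply_eq_apply_add (φ i) (g p) p, hp]
  rw [e1, AffEnd.mul_apply, AffEnd.mul_apply, hp, e2]
  simp only [ContinuousLinearMap.coe_coe, sub_apply, one_apply_eq_self]
  abel

end IsSystem

end System

/-! ### Invariant cones, and systems with a proximal element. -/

section Proximal

variable {V : Type*} [NormedAddCommGroup V] [InnerProductSpace ℝ V]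

/-- The open double cone of opening `κ` around `u`, transversal to the kernel of `w`. -/
def cone (u : V) (w : V →L[ℝ] ℝ) (κ : ℝ) : Set V := {x | ‖x - w x • u‖ < κ * |w x|}

variable {u : V} {w : V →L[ℝ] ℝ} {κ : ℝ}

theorem isOpen_cone : IsOpen (cone u w κ) := isOpen_lt (by fun_prop) (by fun_prop)

theorem ne_zero_of_mem_cone {x : V} (hx : x ∈ cone u w κ) : w x ≠ 0 := by
  intro h
  have : ‖x - w x • u‖ < κ * |w x| := hx
  rw [h, abs_zero, mul_zero] at this
  exact absurd this (not_lt.2 (norm_nonneg _))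

theorem smul_mem_cone {x : V} (hx : x ∈ cone u w κ) {a : ℝ} (ha : a ≠ 0) : a • x ∈ cone u w κ := by
  have h1 : ‖x - w x • u‖ < κ * |w x| := hx
  change ‖a • x - w (a • x) • u‖ < κ * |w (a • x)|
  rw [map_smul, smul_eq_mul, mul_smul, ← smul_sub, norm_smul, abs_mul, Real.norm_eq_abs]
  have : 0 < |a| := abs_pos.2 ha
  nlinarith

theorem norm_le_of_mem_cone {x : V} (hx : x ∈ cone u w κ) : ‖x‖ ≤ (‖u‖ + κ) * |w x| := by
  have h1 : ‖x - w x • u‖ < κ * |w x| := hx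
  have h2 : ‖w x • u‖ = ‖u‖ * |w x| := by rw [norm_smul, Real.norm_eq_abs, mul_comm]
  have h3 := norm_add_le (x - w x • u) (w x • u)
  rw [sub_add_cancel] at h3
  linarith

theorem mem_cone_of_lt {x : V} (hw : w x ≠ 0) (h : ‖x - w x • u‖ / |w x| < κ) :
    x ∈ cone u w κ :=
  (div_lt_iff₀ (abs_pos.2 hw)).1 h

/-- Linear maps that preserve a cone have norm comparable to their effect on any vector
of the cone. -/
theorem exists_norm_le_of_mapsTo_cone (hκ : 0 < κ) {v : V} (hv : v ∈ cone u w κ) :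
    ∃ C > 0, ∀ A : V →L[ℝ] V, (∀ x ∈ cone u w κ, A x ∈ cone u w κ) → ‖A‖ ≤ C * |w (A v)| := by
  obtain ⟨τ, hτ, hball⟩ := Metric.isOpen_iff.1 isOpen_cone v hv
  set a : ℝ := ‖u‖ + κ with ha
  have ha0 : 0 < a := by positivity
  refine ⟨2 / τ * (3 * a), by positivity, fun A hA => ?_⟩
  have hAv := norm_le_of_mem_cone (hA v hv)
  have small : ∀ x : V, ‖x‖ < τ → ‖A x‖ ≤ 3 * a * |w (A v)| := by
    intro x hx
    have hmem : ∀ s : ℝ, |s| ≤ 1 → v + s • x ∈ cone u w κ := fun s hs => hball (by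
      rw [Metric.mem_ball, dist_eq_norm, add_sub_cancel_left, norm_smul, Real.norm_eq_abs]
      exact (mul_le_of_le_one_left (norm_nonneg _) hs).trans_lt hx)
    -- Otherwise some `v + s • x` with `|s| ≤ 1`, still in the cone, would be sent into the kernel
    -- of `w`, which the cone avoids.
    have hw : |w (A x)| ≤ |w (A v)| := by
      by_contra hlt
      push Not at hlt
      have hne : w (A x) ≠ 0 := fun h0 => by
        rw [h0, abs_zero] at hlt; exact absurd hlt (not_lt.2 (abs_nonneg _))
      refine ne_zero_of_mem_cone (hA _ (hmem (-(w (A v)) / w (A x)) ?_)) ?_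
      · rw [abs_div, abs_neg]; exact (div_le_one (abs_pos.2 hne)).2 hlt.le
      · rw [map_add, map_smul, map_add, map_smul, smul_eq_mul, div_mul_cancel₀ _ hne]; ring
    have h1 := norm_le_of_mem_cone (hA _ (hmem 1 (by simp)))
    rw [one_smul, map_add, map_add] at h1
    have h2 : ‖A x‖ ≤ ‖A v + A x‖ + ‖A v‖ := by
      have := norm_sub_le (A v + A x) (A v)
      rwa [add_sub_cancel_left] at this
    have h3 : a * |w (A v) + w (A x)| ≤ a * (2 * |w (A v)|) := by
      gcongr
      linarith [abs_add_le (w (A v)) (w (A x))]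
    linarith
  refine A.opNorm_le_bound (by positivity) fun x => ?_
  by_cases hx : x = 0
  · simp [hx]
  have hx0 : 0 < ‖x‖ := norm_pos_iff.2 hx
  have h4 := small ((τ / 2 / ‖x‖) • x) (by
    rw [norm_smul, Real.norm_of_nonneg (by positivity), div_mul_cancel₀ _ hx0.ne']; linarith)
  rw [map_smul, norm_smul, Real.norm_of_nonneg (by positivity)] at h4
  calc ‖A x‖ = 2 / τ * ‖x‖ * (τ / 2 / ‖x‖ * ‖A x‖) := by field_simp
    _ ≤ 2 / τ * ‖x‖ * (3 * a * |w (A v)|) := by gcongr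
    _ = _ := by ring

/-- High powers of a proximal map send a cone close to its dominant direction. -/
theorem eventually_pow_apply_cone {M : V →L[ℝ] V} {r : ℝ} (hr : r ≠ 0)
    (hlim : Tendsto (fun k : ℕ => (r ^ k)⁻¹ • M ^ k) atTop (𝓝 (w.smulRight u))) (hκ : 0 < κ)
    {η : ℝ} (hη : 0 < η) :
    ∀ᶠ k : ℕ in atTop, ∀ x ∈ cone u w κ, ∃ e : V,
      ‖e‖ < η ∧ (M ^ k) x = (r ^ k * w x) • (u + e) := by
  set a : ℝ := ‖u‖ + κ with ha
  have ha0 : 0 < a := by positivity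
  have h1 := hlim.eventually (Metric.ball_mem_nhds _ (show 0 < η / a by positivity))
  filter_upwards [h1] with k hk x hx
  rw [dist_eq_norm] at hk
  set D := (r ^ k)⁻¹ • M ^ k - w.smulRight u with hD
  have hwx := ne_zero_of_mem_cone hx
  have hrk : r ^ k ≠ 0 := pow_ne_zero _ hr
  have hMD : (M ^ k) x = (r ^ k) • (w x • u + D x) := by
    simp [hD, smul_smul, hrk]
  refine ⟨(w x)⁻¹ • D x, ?_, ?_⟩
  · rw [norm_smul, norm_inv, Real.norm_eq_abs, inv_mul_lt_iff₀ (abs_pos.2 hwx)]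
    have h2 := norm_le_of_mem_cone hx
    calc ‖D x‖ ≤ ‖D‖ * ‖x‖ := D.le_opNorm _
      _ ≤ ‖D‖ * (a * |w x|) := by gcongr
      _ < η / a * (a * |w x|) := by
          have := abs_pos.2 hwx
          gcongr
      _ = |w x| * η := by field_simp
  · rw [hMD, mul_smul, smul_add (w x), smul_smul (w x), mul_inv_cancel₀ hwx, one_smul]

variable [FiniteDimensional ℝ V]

/-- Thickness of the attractor of a system whose monoid contains a proximal element for which the
orbit of the dominant direction spans. -/
theorem IsSystem.thick_of_proximal {ι : Type*} {φ : ι → AffEnd V} {E : Set V} (h : IsSystem φ E)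
    {g : AffEnd V} (hg : g ∈ monoid φ) (hg1 : ‖g.lin‖ < 1) {r : ℝ} (hr : r ≠ 0)
    (hwu : w u = 1)
    (hlim : Tendsto (fun k : ℕ => (r ^ k)⁻¹ • g.lin ^ k) atTop (𝓝 (w.smulRight u)))
    (hspan : Submodule.span ℝ {x : V | ∃ f ∈ monoid φ, f.lin u = x} = ⊤) :
    ∃ n : ℕ, 1 ≤ n ∧ (interior (n • E)).Nonempty := by
  have hu0 : u ≠ 0 := fun h0 => by simp [h0] at hwu
  have : Nontrivial V := ⟨⟨u, 0, hu0⟩⟩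
  obtain ⟨p, hp⟩ := AffEnd.exists_fixed g hg1
  -- a map `ψ` that separates the fixed point and does not kill the dominant direction
  obtain ⟨ψ, hψ, hψp, hψu⟩ : ∃ ψ ∈ monoid φ, w (ψ p) ≠ w p ∧ w (ψ.lin u) ≠ 0 := by
    obtain ⟨y, hy⟩ := (InnerProductSpace.toDual ℝ V).surjective w
    have hwy : ∀ x, w x = ⟪y, x⟫_ℝ := fun x => by rw [← hy]; rfl
    have hy0 : y ≠ 0 := fun h0 => by simp [hwy, h0] at hwu
    obtain ⟨ψ₁, hψ₁, hne⟩ := h.exists_inner_ne p hy0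
    rw [← hwy, ← hwy] at hne
    obtain ⟨C, hC, hbd⟩ := h.orbit_bound p
    -- The map sought is `ψ₁ * g ^ k * ψ₂`. For large `k` the middle factor brings `ψ₂ p` back to
    -- `p`, so separation by `ψ₁` persists, and `ψ₂` is free to make the functional non-zero on the
    -- image of `u`.
    have hl : Tendsto (fun k : ℕ => ‖w‖ * (‖g.lin ^ k‖ * C)) atTop (𝓝 0) := by
      simpa using ((tendsto_pow_atTop_nhds_zero_of_norm_lt_one hg1).norm.mul_const C).const_mul ‖w‖
    obtain ⟨k, hk⟩ := (hl.eventually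
      (gt_mem_nhds (show 0 < |w (ψ₁ p) - w p| from abs_pos.2 (sub_ne_zero.2 hne)))).exists
    obtain ⟨ψ₂, hψ₂, hne₂⟩ : ∃ ψ₂ ∈ monoid φ, w ((ψ₁ * g ^ k).lin (ψ₂.lin u)) ≠ 0 := by
      by_contra hcon
      push Not at hcon
      have h1 : ∀ x, w ((ψ₁ * g ^ k).lin x) = 0 := by
        intro x
        have hx : x ∈ Submodule.span ℝ {x : V | ∃ f ∈ monoid φ, f.lin u = x} := by
          rw [hspan]; trivial
        induction hx using Submodule.span_induction with
        | mem x hx => obtain ⟨f, hf, rfl⟩ := hx; exact hcon f hf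
        | zero => simp
        | add x y _ _ hx hy => rw [map_add, map_add, hx, hy, add_zero]
        | smul a x _ hx => rw [map_smul, map_smul, hx, smul_zero]
      obtain ⟨U, hU⟩ := h.isUnit_lin (mul_mem hψ₁ (pow_mem hg k))
      have h2 := h1 ((↑U⁻¹ : V →L[ℝ] V) u)
      rw [← hU, ← mul_apply_eq_comp, Units.mul_inv, one_apply_eq_self, hwu] at h2
      exact one_ne_zero h2
    refine ⟨ψ₁ * g ^ k * ψ₂, mul_mem (mul_mem hψ₁ (pow_mem hg k)) hψ₂, fun heq => ?_, hne₂⟩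
    have e1 : (ψ₁ * g ^ k * ψ₂) p - ψ₁ p = ψ₁.lin ((g.lin ^ k) (ψ₂ p - p)) := by
      rw [AffEnd.mul_apply, AffEnd.mul_apply, AffEnd.apply_sub_apply, AffEnd.pow_apply_sub hp]
    have e2 : |w (ψ₁ p) - w p| ≤ ‖w‖ * (‖g.lin ^ k‖ * C) := by
      rw [← heq, abs_sub_comm, ← map_sub, e1, ← Real.norm_eq_abs]
      refine (w.le_opNorm _).trans ?_
      gcongr
      refine (ψ₁.lin.le_opNorm _).trans
        ((mul_le_of_le_one_left (norm_nonneg _) (h.norm_le_one hψ₁)).trans ?_)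
      refine ((g.lin ^ k).le_opNorm _).trans ?_
      gcongr
      exact (hbd ψ₂ hψ₂).2.2
    linarith
  -- the invariant cone
  set v₀ : V := p - ψ p with hv₀
  have hwv₀ : w v₀ ≠ 0 := by rw [hv₀, map_sub]; exact sub_ne_zero.2 hψp.symm
  set κ₁ := ‖v₀ - w v₀ • u‖ / |w v₀| with hκ₁
  set κ₂ := ‖ψ.lin u - w (ψ.lin u) • u‖ / |w (ψ.lin u)| with hκ₂
  have hκ₁0 : 0 ≤ κ₁ := by positivity
  have hκ₂0 : 0 ≤ κ₂ := by positivity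
  -- An opening wide enough for the open cone to contain both `v₀` and `ψ.lin u`; it contains `u` in
  -- any case.
  set κ := κ₁ + κ₂ + 1 with hκdef
  have hκ : 0 < κ := by positivity
  set K := cone u w κ with hK
  have hv₀K : v₀ ∈ K := mem_cone_of_lt hwv₀ (by rw [← hκ₁]; linarith)
  have hψuK : ψ.lin u ∈ K := mem_cone_of_lt hψu (by rw [← hκ₂]; linarith)
  have huK : u ∈ K := by
    change ‖u - w u • u‖ < κ * |w u|
    simp [hwu, hκ]
  obtain ⟨ε, hε, hεK⟩ := Metric.isOpen_iff.1 (isOpen_cone (u := u) (w := w) (κ := κ)) v₀ hv₀K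
  obtain ⟨η₁, hη₁, hη₁K⟩ := Metric.isOpen_iff.1 (isOpen_cone (u := u) (w := w) (κ := κ)) u huK
  obtain ⟨η₂, hη₂, hη₂K⟩ :=
    Metric.isOpen_iff.1 (isOpen_cone (u := u) (w := w) (κ := κ)) _ hψuK
  -- finitely many maps moving the dominant direction to a spanning set
  obtain ⟨t, htX, ht⟩ := exists_finset_span hspan
  choose β hβ hβu using fun x : t => htX x.2
  obtain ⟨δ, hδ, hδt⟩ := exists_pos_le_sum_abs_inner (fun x : t => (x : V))
    fun y hy => eq_zero_of_span_eq_top ht fun x hx => hy ⟨x, hx⟩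
  have : Nonempty t := by
    by_contra hemp
    rw [not_nonempty_iff] at hemp
    have := hδt u
    simp only [Finset.univ_eq_empty, Finset.sum_empty] at this
    nlinarith [norm_pos_iff.2 hu0]
  set N : ℝ := (Fintype.card t : ℝ) with hN
  have hN0 : 0 < N := by rw [hN]; exact_mod_cast Fintype.card_pos
  -- The first two bounds keep perturbations of `u` and `ψ.lin u` in the cone; the third keeps the
  -- total error over `t` below half of `δ`.
  set η := min (min η₁ η₂) (δ / (2 * N)) with hη
  have hη0 : 0 < η := by positivity
  set ψs : Bool → AffEnd V := fun b => if b then 1 else ψ with hψs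
  have hψs1 : ∀ b, ψs b ∈ monoid φ := by
    rintro (_ | _)
    exacts [hψ, one_mem _]
  obtain ⟨k, hkcone, hkbar, hk1⟩ := ((eventually_pow_apply_cone hr hlim hκ hη0).and
    ((AffEnd.barycentre_near ψs (fun b => h.norm_le_one (hψs1 b)) g hg1 hp
      (show 0 < ε / 3 by positivity)).and
    ((tendsto_pow_atTop_nhds_zero_of_norm_lt_one hg1).norm.eventually
      (gt_mem_nhds (show ‖(0 : V →L[ℝ] V)‖ < 1 by simp))))).exists
  -- Both `g ^ k` and `ψ * g ^ k` squeeze the cone close to a direction inside it. With two maps the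
  -- barycentric displacements are opposite halves of `v`, and `v` is close to `v₀`.
  set F : Bool → AffEnd V := fun b => ψs b * g ^ k with hF
  have hFmem : ∀ b, F b ∈ monoid φ := fun b => mul_mem (hψs1 b) (pow_mem hg k)
  have hFn : ∀ b, ‖(F b).lin‖ ≤ ‖g.lin ^ k‖ := fun b => by
    rw [hF, AffEnd.mul_lin, AffEnd.pow_lin]
    exact (norm_mul_le _ _).trans
      (mul_le_of_le_one_left (norm_nonneg _) (h.norm_le_one (hψs1 b)))
  obtain ⟨c, hc⟩ := AffEnd.exists_barycentre F hk1 hFn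
  have hnear := (hkbar c hc).2
  set v : V := F true c - F false c with hv
  have hvK : v ∈ K := hεK (by
    rw [Metric.mem_ball, dist_eq_norm]
    have e1 : v - v₀ = (F true c - p) - (F false c - ψ p) := by rw [hv, hv₀]; abel
    have e2 : ‖F true c - p‖ ≤ ε / 3 := by
      simpa [hψs, hF, AffEnd.one_apply] using hnear true
    have e3 : ‖F false c - ψ p‖ ≤ ε / 3 := hnear false
    rw [e1]
    linarith [norm_sub_le (F true c - p) (F false c - ψ p)])
  have hvF : F true c - c = (1 / 2 : ℝ) • v := by
    have e1 : (F true c - c) + (F false c - c) = 0 := by rwa [Fintype.sum_bool] at hc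
    have e2 : v = (2 : ℝ) • (F true c - c) := by
      have e3 : v = (F true c - c) - (F false c - c) := by rw [hv]; abel
      rw [e3, eq_neg_of_add_eq_zero_right e1, two_smul, sub_neg_eq_add]
    rw [e2, smul_smul]; norm_num
  obtain ⟨C, hC, hCA⟩ := exists_norm_le_of_mapsTo_cone hκ hvK
  have hgen : ∀ b, ∀ x ∈ K, (F b).lin x ∈ K := by
    intro b x hx
    obtain ⟨e, he, hMx⟩ := hkcone x hx
    have hne : r ^ k * w x ≠ 0 := mul_ne_zero (pow_ne_zero _ hr) (ne_zero_of_mem_cone hx)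
    have e1 : (F b).lin x = (r ^ k * w x) • (ψs b).lin (u + e) := by
      rw [hF, AffEnd.mul_lin, AffEnd.pow_lin, mul_apply_eq_comp, hMx, map_smul]
    rw [e1]
    refine smul_mem_cone ?_ hne
    cases b with
    | true =>
      refine hη₁K ?_
      have : (ψs true).lin (u + e) = u + e := by simp [hψs]
      rw [this, Metric.mem_ball, dist_eq_norm, add_sub_cancel_left]
      exact he.trans_le ((min_le_left _ _).trans (min_le_left _ _))
    | false =>
      refine hη₂K ?_
      have : (ψs false).lin (u + e) = ψ.lin u + ψ.lin e := by simp [hψs]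
      rw [this, Metric.mem_ball, dist_eq_norm, add_sub_cancel_left]
      refine ((ψ.lin.le_opNorm _).trans
        (mul_le_of_le_one_left (norm_nonneg _) (h.norm_le_one hψ))).trans_lt ?_
      exact he.trans_le ((min_le_left _ _).trans (min_le_right _ _))
  have hrk : 0 < |r ^ k| := abs_pos.2 (pow_ne_zero _ hr)
  -- For `A` preserving the cone, `A v` lies in the cone and `|w (A v)|` is comparable to `‖A‖`.
  -- Then `g ^ k` turns `A v` close to the direction `u`, and `β x` carries `u` to the member `x` of
  -- the spanning set `t`.
  refine thick_of_scale h.compact h.nonempty F (fun b => h.mapsTo (hFmem b)) hk1 hFn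
    (fun b => h.isUnit_lin (hFmem b)) (fun x : t => β x * g ^ k)
    (fun x => h.mapsTo (mul_mem (hβ x) (pow_mem hg k))) {A | ∀ x ∈ K, A x ∈ K}
    (fun x hx => hx) (fun A hA b x hx => hA _ (hgen b x hx)) hc
    (δ := |r ^ k| * C⁻¹ * (1 / 2) * (δ / 2)) (by positivity) ?_
  intro A hA y
  have term : ∀ x : t, |r ^ k| * C⁻¹ * (1 / 2) * (|⟪y, (x : V)⟫_ℝ| - ‖y‖ * η) ≤
      ‖A x‖⁻¹ * ∑ b, |⟪y, (β x * g ^ k).lin (A x (F b c - c))⟫_ℝ| := by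
    intro x
    have hAv := hA x v hvK
    have hwA := ne_zero_of_mem_cone hAv
    have hA0 : 0 < ‖A x‖ := norm_pos_iff.2 fun h0 => by simp [h0] at hwA
    obtain ⟨e, he, hMx⟩ := hkcone _ hAv
    have e1 : (β x * g ^ k).lin (A x (F true c - c)) =
        (1 / 2 * (r ^ k * w (A x v))) • ((x : V) + (β x).lin e) := by
      rw [hvF, map_smul, map_smul, AffEnd.mul_lin, AffEnd.pow_lin, mul_apply_eq_comp, hMx, map_smul,
        map_add, hβu, smul_smul]
    have e2 : |⟪y, (x : V)⟫_ℝ| - ‖y‖ * η ≤ |⟪y, (x : V) + (β x).lin e⟫_ℝ| := by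
      have e3 : |⟪y, (β x).lin e⟫_ℝ| ≤ ‖y‖ * η := by
        refine (abs_real_inner_le_norm _ _).trans ?_
        gcongr
        exact ((β x).lin.le_opNorm _).trans
          ((mul_le_of_le_one_left (norm_nonneg _) (h.norm_le_one (hβ x))).trans he.le)
      rw [inner_add_right]
      have := abs_sub_abs_le_abs_sub ⟪y, (x : V)⟫_ℝ (-⟪y, (β x).lin e⟫_ℝ)
      rw [abs_neg, sub_neg_eq_add] at this
      linarith
    have e4 : C⁻¹ ≤ ‖A x‖⁻¹ * |w (A x v)| := by
      rw [inv_mul_eq_div, le_div_iff₀ hA0, inv_mul_le_iff₀ hC]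
      exact hCA (A x) (hA x)
    calc |r ^ k| * C⁻¹ * (1 / 2) * (|⟪y, (x : V)⟫_ℝ| - ‖y‖ * η)
        ≤ |r ^ k| * C⁻¹ * (1 / 2) * |⟪y, (x : V) + (β x).lin e⟫_ℝ| := by gcongr
      _ ≤ |r ^ k| * (‖A x‖⁻¹ * |w (A x v)|) * (1 / 2) * |⟪y, (x : V) + (β x).lin e⟫_ℝ| := by gcongr
      _ = ‖A x‖⁻¹ * |⟪y, (β x * g ^ k).lin (A x (F true c - c))⟫_ℝ| := by
          rw [e1, inner_smul_right, abs_mul, abs_mul, abs_mul, abs_of_pos (show (0 : ℝ) < 1 / 2 by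
            norm_num)]
          ring
      _ ≤ _ := by
          gcongr
          exact Finset.single_le_sum
            (f := fun b => |⟪y, (β x * g ^ k).lin (A x (F b c - c))⟫_ℝ|)
            (fun _ _ => abs_nonneg _) (Finset.mem_univ true)
  refine le_trans ?_ (Finset.sum_le_sum fun x _ => term x)
  rw [← Finset.mul_sum, Finset.sum_sub_distrib, mul_assoc (|r ^ k| * C⁻¹ * (1 / 2))]
  have e5 : ∑ x : t, ‖y‖ * η ≤ δ / 2 * ‖y‖ := by
    rw [Finset.sum_const, Finset.card_univ, nsmul_eq_mul]
    have : N * η ≤ δ / 2 := by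
      calc N * η ≤ N * (δ / (2 * N)) := by gcongr; exact min_le_right _ _
        _ = δ / 2 := by field_simp
    calc N * (‖y‖ * η) = (N * η) * ‖y‖ := by ring
      _ ≤ _ := by gcongr
  have e6 := hδt y
  gcongr
  linarith

end Proximal

/-! ### Powers of a matrix with a simple dominant eigenvalue. -/

section Dominant

/-- Powers of an element with spectral radius less than one tend to zero. -/
theorem tendsto_pow_of_spectrum {A : Type*} [NormedRing A] [NormedAlgebra ℂ A] [CompleteSpace A]
    [Nontrivial A] (a : A) (ha : ∀ z ∈ spectrum ℂ a, ‖z‖ < 1) :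
    Tendsto (fun k : ℕ => a ^ k) atTop (𝓝 0) := by
  have h1 : spectralRadius ℂ a < (1 : NNReal) :=
    spectrum.spectralRadius_lt_of_forall_lt a fun z hz => by exact_mod_cast ha z hz
  obtain ⟨q, hq1, hq2⟩ := ENNReal.lt_iff_exists_nnreal_btwn.1 h1
  have hq2' : q < 1 := by exact_mod_cast hq2
  have h2 := (spectrum.pow_nnnorm_pow_one_div_tendsto_nhds_spectralRadius a).eventually
    (gt_mem_nhds hq1)
  have h3 : ∀ᶠ k : ℕ in atTop, ‖a ^ k‖ ≤ (q : ℝ) ^ k := by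
    filter_upwards [h2, eventually_gt_atTop 0] with k hk hk0
    have hk' : (k : ℝ) ≠ 0 := by exact_mod_cast hk0.ne'
    have h4 : ((‖a ^ k‖₊ : ENNReal) ^ (1 / k : ℝ)) ^ (k : ℝ) ≤ (q : ENNReal) ^ (k : ℝ) :=
      ENNReal.rpow_le_rpow hk.le (by positivity)
    rw [← ENNReal.rpow_mul, one_div_mul_cancel hk', ENNReal.rpow_one, ENNReal.rpow_natCast] at h4
    have h5 : ‖a ^ k‖₊ ≤ q ^ k := by exact_mod_cast h4
    exact_mod_cast h5
  exact squeeze_zero_norm' h3 (tendsto_pow_atTop_nhds_zero_of_lt_one q.2 (by exact_mod_cast hq2'))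

/-- A real matrix all of whose complex eigenvalues are of modulus less than one has powers
tending to zero. -/
theorem tendsto_pow_toEuclideanCLM {d : ℕ} [NeZero d] (N : Matrix (Fin d) (Fin d) ℝ)
    (hN : ∀ z ∈ spectrum ℂ (N.map (algebraMap ℝ ℂ)), ‖z‖ < 1) :
    Tendsto (fun k : ℕ => (Matrix.toEuclideanCLM (n := Fin d) (𝕜 := ℝ) N) ^ k) atTop (𝓝 0) := by
  set Φ := Matrix.toEuclideanCLM (n := Fin d) (𝕜 := ℂ)
  set Ψ := Matrix.toEuclideanCLM (n := Fin d) (𝕜 := ℝ)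
  have h1 : Tendsto (fun k : ℕ => (Φ (N.map (algebraMap ℝ ℂ))) ^ k) atTop (𝓝 0) := by
    refine tendsto_pow_of_spectrum _ fun z hz => hN z ?_
    rwa [AlgEquiv.spectrum_eq Φ] at hz
  have hc1 : Continuous (fun X => Φ.symm X) :=
    (Φ.symm.toAlgEquiv.toLinearMap).continuous_of_finiteDimensional
  have hc2 : Continuous (fun X => Ψ X) :=
    (Ψ.toAlgEquiv.toLinearMap).continuous_of_finiteDimensional
  have hc3 : Continuous (fun X : Matrix (Fin d) (Fin d) ℂ => X.map Complex.re) :=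
    Continuous.matrix_map continuous_id Complex.continuous_re
  -- Complex powers of a real matrix are real, so entrywise real parts recover the real powers.
  have h2 := ((hc2.comp (hc3.comp hc1)).tendsto 0).comp h1
  have e0 : ((fun X => Ψ X) ∘ (fun X : Matrix (Fin d) (Fin d) ℂ => X.map Complex.re) ∘
      fun X => Φ.symm X) 0 = 0 := by
    simp only [Function.comp, map_zero]
    have : (0 : Matrix (Fin d) (Fin d) ℂ).map Complex.re = 0 := by ext i j; simp
    rw [this, map_zero]
  rw [e0] at h2
  refine h2.congr fun k => ?_
  simp only [Function.comp]
  rw [← map_pow, StarAlgEquiv.symm_apply_apply, ← map_pow]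
  congr 1
  have : (N.map (algebraMap ℝ ℂ)) ^ k = (N ^ k).map (algebraMap ℝ ℂ) := by
    have := map_pow (algebraMap ℝ ℂ).mapMatrix N k
    simpa using this.symm
  rw [this]
  ext i j
  simp

/-- Normalized powers of a matrix with a simple dominant eigenvalue converge to a projection
of rank one. -/
theorem exists_rank_one_limit {d : ℕ} [NeZero d] (M : Matrix (Fin d) (Fin d) ℝ) (hM : IsUnit M)
    (hdom : HasSimpleDominantEigenvalue M) :
    ∃ (r : ℝ) (u : EuclideanSpace ℝ (Fin d)) (w : EuclideanSpace ℝ (Fin d) →L[ℝ] ℝ), r ≠ 0 ∧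
      w u = 1 ∧
      Tendsto (fun k : ℕ => (r ^ k)⁻¹ • (Matrix.toEuclideanCLM (n := Fin d) (𝕜 := ℝ) M) ^ k) atTop
        (𝓝 (w.smulRight u)) := by
  obtain ⟨z, hz1, hz⟩ := hdom
  set Mc := M.map (algebraMap ℝ ℂ) with hMc
  have hcp : Mc.charpoly = M.charpoly.map (algebraMap ℝ ℂ) := Matrix.charpoly_map M _
  have hzroot : Mc.charpoly.IsRoot z := by
    rw [← Polynomial.rootMultiplicity_pos (Matrix.charpoly_monic _).ne_zero, hz1]; norm_num
  -- the dominant eigenvalue is real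
  obtain ⟨r, rfl⟩ : ∃ r : ℝ, (r : ℂ) = z := by
    have hconj : Mc.charpoly.IsRoot ((starRingEnd ℂ) z) := by
      rw [Polynomial.IsRoot.def, hcp, Polynomial.eval_map_algebraMap] at hzroot ⊢
      have := Polynomial.aeval_conj M.charpoly z
      rw [this, hzroot, map_zero]
    by_contra hne
    have h1 : (starRingEnd ℂ) z ≠ z := fun h => hne (Complex.conj_eq_iff_real.1 h |>.imp
      fun _ h => h.symm)
    have := hz _ hconj h1
    rw [RCLike.norm_conj] at this
    exact lt_irrefl _ this
  have hmul : M.charpoly.rootMultiplicity r = 1 := by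
    rw [← hz1, hcp]
    exact Polynomial.eq_rootMultiplicity_map (algebraMap ℝ ℂ).injective r
  have hrroot : M.charpoly.IsRoot r := by
    rw [← Polynomial.rootMultiplicity_pos (Matrix.charpoly_monic _).ne_zero, hmul]; norm_num
  have hr : r ≠ 0 := by
    rintro rfl
    have := Matrix.mem_spectrum_iff_isRoot_charpoly.2 hrroot
    exact (spectrum.zero_notMem_iff ℝ).2 hM this
  obtain ⟨q, hq, hndvd⟩ := Polynomial.exists_eq_pow_rootMultiplicity_mul_and_not_dvd M.charpoly
    (Matrix.charpoly_monic M).ne_zero r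
  rw [hmul, pow_one] at hq
  have hqr : q.eval r ≠ 0 := fun h => hndvd (Polynomial.dvd_iff_isRoot.2 h)
  -- With characteristic polynomial `(X - r) q`, this is the spectral projection at `r`: simplicity
  -- gives `q(r) ≠ 0`, and Cayley–Hamilton gives `M * Q = r • Q`.
  set Q : Matrix (Fin d) (Fin d) ℝ := (q.eval r)⁻¹ • Polynomial.aeval M q with hQ
  have hMQ : M * Q = r • Q := by
    have h1 := Matrix.aeval_self_charpoly M
    rw [hq, map_mul, map_sub, Polynomial.aeval_X, Polynomial.aeval_C, sub_mul, sub_eq_zero] at h1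
    rw [hQ, mul_smul_comm, h1, Algebra.algebraMap_eq_smul_one, smul_mul_assoc, one_mul, smul_comm]
  have hQM : Q * M = r • Q := by
    rw [← hMQ, hQ, mul_smul_comm, smul_mul_assoc]
    congr 1
    exact (Polynomial.aeval_X (R := ℝ) M ▸ (Polynomial.commute_X q).symm.map (Polynomial.aeval M) :)
  have hpoly : ∀ s : Polynomial ℝ, Polynomial.aeval M s * Q = s.eval r • Q := by
    intro s
    induction s using Polynomial.induction_on' with
    | add a b ha hb => rw [map_add, add_mul, ha, hb, Polynomial.eval_add, add_smul]
    | monomial n a =>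
      rw [Polynomial.aeval_monomial, Polynomial.eval_monomial, Algebra.algebraMap_eq_smul_one,
        smul_mul_assoc, smul_mul_assoc, one_mul, mul_smul]
      congr 1
      induction n with
      | zero => simp
      | succ n ih => rw [pow_succ, mul_assoc, hMQ, mul_smul_comm, ih, smul_smul, pow_succ, mul_comm]
  have hQQ : Q * Q = Q := by
    conv_lhs => rw [hQ, smul_mul_assoc, ← hQ, hpoly, smul_smul, inv_mul_cancel₀ hqr, one_smul]
  set N := r⁻¹ • M - Q with hN
  have hQN : Q * N = 0 := by
    rw [hN, mul_sub, mul_smul_comm, hQM, smul_smul, inv_mul_cancel₀ hr, one_smul, hQQ, sub_self]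
  have hNQ : N * Q = 0 := by
    rw [hN, sub_mul, smul_mul_assoc, hMQ, smul_smul, inv_mul_cancel₀ hr, one_smul, hQQ, sub_self]
  -- The exponent starts at one: at exponent zero the identity would force `Q = 0`.
  have hpow : ∀ k : ℕ, (r⁻¹ • M) ^ (k + 1) = Q + N ^ (k + 1) := by
    intro k
    have e : r⁻¹ • M = Q + N := by rw [hN]; abel
    rw [e]
    induction k with
    | zero => simp
    | succ k ih =>
      rw [pow_succ, ih, add_mul, mul_add, mul_add, hQQ, hQN, pow_succ N k, mul_assoc (N ^ k) N Q,
        hNQ, mul_zero, add_zero, zero_add, ← pow_succ N k, ← pow_succ]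
  -- the spectrum of the remainder
  have hspec : ∀ μ ∈ spectrum ℂ (N.map (algebraMap ℝ ℂ)), ‖μ‖ < 1 := by
    intro μ hμ
    by_cases hμ0 : μ = 0
    · simp [hμ0]
    rw [← Matrix.spectrum_toLin'] at hμ
    -- Since `Q * N = 0` and `μ ≠ 0`, the eigenvector is killed by `Q`, so it is an eigenvector of
    -- `M` for `r * μ`.
    obtain ⟨x, hx⟩ := (Module.End.HasEigenvalue.of_mem_spectrum hμ).exists_hasEigenvector
    have hx0 := hx.2
    have hNx : (N.map (algebraMap ℝ ℂ)).mulVec x = μ • x := by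
      simpa using hx.apply_eq_smul
    set Qc := Q.map (algebraMap ℝ ℂ) with hQc
    have hQNc : Qc * N.map (algebraMap ℝ ℂ) = 0 := by
      rw [hQc, ← Matrix.map_mul, hQN]; ext i j; simp
    have hQx : Qc.mulVec x = 0 := by
      have h1 : Qc.mulVec ((N.map (algebraMap ℝ ℂ)).mulVec x) = 0 := by
        rw [Matrix.mulVec_mulVec, hQNc, Matrix.zero_mulVec]
      rw [hNx, Matrix.mulVec_smul] at h1
      exact (smul_eq_zero.1 h1).resolve_left hμ0
    have hNc : N.map (algebraMap ℝ ℂ) = (r : ℂ)⁻¹ • Mc - Qc := by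
      ext i j; simp [hN, hMc, hQc]
    have hrc : (r : ℂ) ≠ 0 := by exact_mod_cast hr
    have hMx : Mc.mulVec x = (r * μ) • x := by
      rw [hNc, Matrix.sub_mulVec, hQx, sub_zero, Matrix.smul_mulVec] at hNx
      rw [mul_smul, ← hNx, smul_smul, mul_inv_cancel₀ hrc, one_smul]
    have hev : Module.End.HasEigenvector (Matrix.toLin' Mc) (r * μ) x :=
      Module.End.hasEigenvector_iff.2 ⟨Module.End.mem_eigenspace_iff.2 (by simpa using hMx), hx0⟩
    have hroot : Mc.charpoly.IsRoot (r * μ) := by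
      rw [← Matrix.mem_spectrum_iff_isRoot_charpoly, ← Matrix.spectrum_toLin']
      exact (Module.End.hasEigenvalue_of_hasEigenvector hev).mem_spectrum
    -- On eigenvectors of `M` for `r`, `Q` acts as the identity, whereas it kills `x`.
    have hne : (r : ℂ) * μ ≠ r := by
      intro heq
      rw [heq] at hMx
      have hpow' : ∀ n : ℕ, (Mc ^ n).mulVec x = ((r : ℂ) ^ n) • x := by
        intro n
        induction n with
        | zero => simp
        | succ n ih =>
          rw [pow_succ, ← Matrix.mulVec_mulVec, hMx, Matrix.mulVec_smul, ih, smul_smul, pow_succ,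
            mul_comm]
      have hs : ∀ s : Polynomial ℝ, ((Polynomial.aeval M s).map (algebraMap ℝ ℂ)).mulVec x =
          ((s.eval r : ℝ) : ℂ) • x := by
        intro s
        induction s using Polynomial.induction_on' with
        | add a b ha hb =>
          rw [map_add, Polynomial.eval_add, Complex.ofReal_add, add_smul, ← ha, ← hb,
            ← Matrix.add_mulVec]
          congr 1
          ext i j; simp
        | monomial n a =>
          have e1 : (Polynomial.aeval M (Polynomial.monomial n a)).map (algebraMap ℝ ℂ) =
              (a : ℂ) • Mc ^ n := by
            have e2 : Mc ^ n = (M ^ n).map (algebraMap ℝ ℂ) := by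
              exact (map_pow (algebraMap ℝ ℂ).mapMatrix M n).symm
            rw [Polynomial.aeval_monomial, Algebra.algebraMap_eq_smul_one, smul_mul_assoc, one_mul,
              e2]
            ext i j; simp
          rw [e1, Matrix.smul_mulVec, hpow', Polynomial.eval_monomial, smul_smul]
          push_cast
          rfl
      have h1 : Qc.mulVec x = x := by
        have e3 : Qc = ((q.eval r : ℝ) : ℂ)⁻¹ • (Polynomial.aeval M q).map (algebraMap ℝ ℂ) := by
          ext i j; simp [hQc, hQ]
        rw [e3, Matrix.smul_mulVec, hs, smul_smul, inv_mul_cancel₀ (by exact_mod_cast hqr),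
          one_smul]
      exact hx0 (h1 ▸ hQx)
    have := hz _ hroot hne
    rw [norm_mul] at this
    have hrn : 0 < ‖(r : ℂ)‖ := norm_pos_iff.2 hrc
    nlinarith
  -- the limit and its range
  set Ψ := Matrix.toEuclideanCLM (n := Fin d) (𝕜 := ℝ) with hΨ
  have hlim : Tendsto (fun k : ℕ => (r ^ k)⁻¹ • (Ψ M) ^ k) atTop (𝓝 (Ψ Q)) := by
    rw [← tendsto_add_atTop_iff_nat 1]
    have h1 := (tendsto_add_atTop_iff_nat 1).2 (tendsto_pow_toEuclideanCLM N hspec)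
    have h2 := h1.const_add (Ψ Q)
    rw [add_zero] at h2
    refine h2.congr fun k => ?_
    rw [← map_pow, ← map_pow, ← map_smul, ← map_add, ← hpow, smul_pow, inv_pow]
  have hrank : Module.finrank ℝ (Module.End.eigenspace (Ψ M).toLinearMap r) ≤ 1 := by
    refine (LinearMap.finrank_eigenspace_le _ _).trans ?_
    have e1 : (Ψ M).toLinearMap.charpoly = M.charpoly := by
      rw [hΨ, Matrix.coe_toEuclideanCLM_eq_toEuclideanLin]
      change (Matrix.toLpLin 2 2 M).charpoly = _
      rw [Matrix.toLpLin_eq_toLin]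
      exact Matrix.charpoly_toLin _ _
    rw [e1, hmul]
  -- If `Q` vanished, `N` would be `r⁻¹ • M` and have the eigenvalue `1`.
  obtain ⟨x, hx⟩ : ∃ x, Ψ Q x ≠ 0 := by
    by_contra hcon
    push Not at hcon
    have h1 : Ψ Q = 0 := by ext1 x; simpa using hcon x
    have h2 : Q = 0 := by
      have := congrArg Ψ.symm h1
      simpa using this
    have h4 : r⁻¹ • M = N := by rw [hN, h2, sub_zero]
    have h5 : ((1 : ℝ) : ℂ) ∈ spectrum ℂ (N.map (algebraMap ℝ ℂ)) := by
      rw [← Matrix.spectrum_toLin']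
      have hrs : (r : ℂ) ∈ spectrum ℂ Mc := Matrix.mem_spectrum_iff_isRoot_charpoly.2 hzroot
      rw [← Matrix.spectrum_toLin'] at hrs
      obtain ⟨x, hx⟩ := (Module.End.HasEigenvalue.of_mem_spectrum hrs).exists_hasEigenvector
      have hMx : Mc.mulVec x = (r : ℂ) • x := by simpa using hx.apply_eq_smul
      have e4 : N.map (algebraMap ℝ ℂ) = (r : ℂ)⁻¹ • Mc := by
        rw [← h4]; ext i j; simp [hMc]
      refine (Module.End.hasEigenvalue_of_hasEigenvector (x := x)
        (Module.End.hasEigenvector_iff.2 ⟨Module.End.mem_eigenspace_iff.2 ?_, hx.2⟩)).mem_spectrum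
      rw [Matrix.toLin'_apply, e4, Matrix.smul_mulVec, hMx, smul_smul,
        inv_mul_cancel₀ (by exact_mod_cast hr)]
      simp
    have := hspec _ h5
    simp at this
  set u := Ψ Q x with hu
  have hQu : Ψ Q u = u := by
    rw [hu, ← mul_apply_eq_comp, ← map_mul, hQQ]
  have hΨM : ∀ y, Ψ M (Ψ Q y) = r • Ψ Q y := fun y => by
    rw [← mul_apply_eq_comp, ← map_mul, hMQ, map_smul, smul_apply]
  have hmem : ∀ y, Ψ Q y ∈ Module.End.eigenspace (Ψ M).toLinearMap r := fun y =>
    Module.End.mem_eigenspace_iff.2 (hΨM y)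
  have hline : ∀ y, ∃ a : ℝ, a • u = Ψ Q y := by
    obtain ⟨⟨v, hv⟩, hvs⟩ := finrank_le_one_iff.1 hrank
    obtain ⟨a, ha⟩ := hvs ⟨u, hmem x⟩
    have ha' : a • v = u := congrArg Subtype.val ha
    have ha0 : a ≠ 0 := fun h => hx (by rw [← ha', h, zero_smul])
    intro y
    obtain ⟨b, hb⟩ := hvs ⟨Ψ Q y, hmem y⟩
    have hb' : b • v = Ψ Q y := congrArg Subtype.val hb
    exact ⟨b * a⁻¹, by rw [← ha', smul_smul, mul_assoc, inv_mul_cancel₀ ha0, mul_one, hb']⟩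
  have huu : ⟪u, u⟫_ℝ ≠ 0 := inner_self_eq_zero.not.2 hx
  set w : EuclideanSpace ℝ (Fin d) →L[ℝ] ℝ := (⟪u, u⟫_ℝ)⁻¹ • (innerSL ℝ u).comp (Ψ Q) with hw
  have hwy : ∀ y, w y = (⟪u, u⟫_ℝ)⁻¹ * ⟪u, Ψ Q y⟫_ℝ := fun y => rfl
  have hws : w.smulRight u = Ψ Q := by
    ext1 y
    obtain ⟨a, ha⟩ := hline y
    rw [ContinuousLinearMap.smulRight_apply, hwy, ← ha, inner_smul_right]
    congr 1
    field_simp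
  refine ⟨r, u, w, hr, ?_, by rw [hws]; exact hlim⟩
  rw [hwy, hQu, inv_mul_cancel₀ huu]

end Dominant

/-! ### Systems with uniformly bounded distortion. -/

section Conformal

variable {V : Type*} [NormedAddCommGroup V] [InnerProductSpace ℝ V]
  {ι : Type*} {φ : ι → AffEnd V} {E : Set V}

theorem IsSystem.eq_one_or_norm_lt (h : IsSystem φ E) {g : AffEnd V} (hg : g ∈ monoid φ) :
    g = 1 ∨ ‖g.lin‖ < 1 := by
  induction hg using Submonoid.closure_induction with
  | mem g hg => obtain ⟨i, rfl⟩ := hg; exact Or.inr (h.norm_gen_lt i)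
  | one => exact Or.inl rfl
  | mul f g hf' hg' hf hg =>
    rcases hf with rfl | hf
    · rwa [one_mul]
    · right
      rw [AffEnd.mul_lin]
      exact (norm_mul_le _ _).trans_lt
        ((mul_le_of_le_one_right (norm_nonneg _) (h.norm_le_one hg')).trans_lt hf)

variable [FiniteDimensional ℝ V]

/-- Thickness of attractors of systems that generate a monoid of linear maps with uniformly bounded
distortion. -/
theorem IsSystem.thick_of_conformal [Nontrivial V] (h : IsSystem φ E) {δ : ℝ} (hδ : 0 < δ)
    (hconf : ∀ g ∈ monoid φ, ∀ y, δ * ‖g.lin‖ * ‖y‖ ≤ ‖ContinuousLinearMap.adjoint g.lin y‖) :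
    ∃ n : ℕ, 1 ≤ n ∧ (interior (n • E)).Nonempty := by
  obtain ⟨i⟩ := h.index_nonempty
  set g := φ i with hgdef
  have hg : g ∈ monoid φ := IsSystem.mem_monoid i
  have hg1 : ‖g.lin‖ < 1 := h.norm_gen_lt i
  obtain ⟨p, hp⟩ := AffEnd.exists_fixed g hg1
  obtain ⟨t, htX, ht⟩ := exists_finset_span (h.span_orbit p)
  choose ψ hψ hψp using fun x : t => htX x.2
  obtain ⟨δ₁, hδ₁, hδt⟩ := exists_pos_le_sum_abs_inner (fun x : t => (x : V))
    fun y hy => eq_zero_of_span_eq_top ht fun x hx => hy ⟨x, hx⟩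
  set N : ℝ := (Fintype.card t : ℝ) with hN
  have hN0 : 0 ≤ N := by positivity
  set ε : ℝ := δ₁ / (4 * (N + 1)) with hε
  have hε0 : 0 < ε := by positivity
  -- At `p` these maps take the values `p` and `p + x`. After precomposition with `g ^ k`, the
  -- values at the barycentre are within `ε` of them, so their differences stay close enough to the
  -- spanning vectors `x`.
  set ψs : Option t → AffEnd V := fun s => s.elim 1 ψ with hψs
  have hψs1 : ∀ s, ψs s ∈ monoid φ := by
    rintro (_ | x)
    exacts [one_mem _, hψ x]
  obtain ⟨k, hkbar, hk1⟩ := ((AffEnd.barycentre_near ψs (fun b => h.norm_le_one (hψs1 b)) g hg1 hp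
      hε0).and ((tendsto_pow_atTop_nhds_zero_of_norm_lt_one hg1).norm.eventually
      (gt_mem_nhds (show ‖(0 : V →L[ℝ] V)‖ < 1 by simp)))).exists
  set F : Option t → AffEnd V := fun s => ψs s * g ^ k with hF
  have hFmem : ∀ s, F s ∈ monoid φ := fun s => mul_mem (hψs1 s) (pow_mem hg k)
  have hFn : ∀ s, ‖(F s).lin‖ ≤ ‖g.lin ^ k‖ := fun s => by
    rw [hF, AffEnd.mul_lin, AffEnd.pow_lin]
    exact (norm_mul_le _ _).trans
      (mul_le_of_le_one_left (norm_nonneg _) (h.norm_le_one (hψs1 s)))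
  obtain ⟨c, hc⟩ := AffEnd.exists_barycentre F hk1 hFn
  have hnear := (hkbar c hc).2
  obtain ⟨δ₂, hδ₂, hδF⟩ := exists_pos_le_sum_abs_inner (fun s => F s c - c) (by
    intro y hy
    have hx : ∀ x : t, |⟪y, (x : V)⟫_ℝ| ≤ ‖y‖ * (2 * ε) := by
      intro x
      have e1 : ‖F none c - p‖ ≤ ε := by
        simpa [hψs, hF, AffEnd.one_apply] using hnear none
      have e2 : ‖F (some x) c - ψ x p‖ ≤ ε := hnear (some x)
      have e3 : (x : V) = ((F (some x) c - c) - (F none c - c)) -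
          ((F (some x) c - ψ x p) - (F none c - p)) := by
        rw [← hψp x]; abel
      rw [e3, inner_sub_right, inner_sub_right, hy, hy, sub_zero, zero_sub, abs_neg]
      refine (abs_real_inner_le_norm _ _).trans ?_
      gcongr
      linarith [norm_sub_le (F (some x) c - ψ x p) (F none c - p)]
    have h1 : δ₁ * ‖y‖ ≤ N * (‖y‖ * (2 * ε)) := by
      refine (hδt y).trans ((Finset.sum_le_sum fun x _ => hx x).trans ?_)
      rw [Finset.sum_const, Finset.card_univ, nsmul_eq_mul]
    have h2 : N * (2 * ε) ≤ δ₁ / 2 := by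
      calc N * (2 * ε) ≤ (N + 1) * (2 * ε) := by gcongr; linarith
        _ = δ₁ / 2 := by rw [hε]; field_simp; norm_num
    by_contra hy0
    have hy1 : 0 < ‖y‖ := norm_pos_iff.2 hy0
    nlinarith)
  -- Moving `A` to the other side of the inner product replaces `y` by its image under the adjoint,
  -- of norm at least `δ * ‖A‖ * ‖y‖`; a single block with `B = 1` is therefore enough.
  refine thick_of_scale (κ := Unit) h.compact h.nonempty F (fun s => h.mapsTo (hFmem s)) hk1 hFn
    (fun s => h.isUnit_lin (hFmem s)) (fun _ => 1) (fun _ => h.mapsTo (one_mem _))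
    {A | ∃ f ∈ monoid φ, f.lin = A} ⟨1, one_mem _, rfl⟩ ?_ hc (δ := δ₂ * δ) (by positivity) ?_
  · rintro _ ⟨f, hf, rfl⟩ s
    exact ⟨f * F s, mul_mem hf (hFmem s), rfl⟩
  · intro A hA y
    obtain ⟨f, hf, hfA⟩ := hA ()
    have hA0 : 0 < ‖A ()‖ := by
      rw [← hfA]; exact norm_pos_iff.2 (h.isUnit_lin hf).ne_zero
    simp only [Finset.univ_unique, PUnit.default_eq_unit, Finset.sum_singleton, AffEnd.one_lin,
      one_apply_eq_self]
    rw [inv_mul_eq_div, le_div_iff₀ hA0]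
    calc δ₂ * δ * ‖y‖ * ‖A ()‖ = δ₂ * (δ * ‖f.lin‖ * ‖y‖) := by rw [hfA]; ring
      _ ≤ δ₂ * ‖ContinuousLinearMap.adjoint f.lin y‖ := by gcongr; exact hconf f hf y
      _ ≤ _ := hδF _
      _ = _ := by simp only [ContinuousLinearMap.adjoint_inner_left, hfA]

end Conformal

/-! ### Systems with triangular linear parts. -/

section Triangular

variable {V : Type*} [NormedAddCommGroup V] [InnerProductSpace ℝ V]

/-- `A` acts as `a` on the line spanned by `e`, and as `c` on the quotient by the kernel of `ξ`. -/
def IsTri (e : V) (ξ : V →L[ℝ] ℝ) (A : V →L[ℝ] V) (a c : ℝ) : Prop :=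
  A e = a • e ∧ ∀ x, ξ (A x) = c * ξ x

variable {e : V} {ξ : V →L[ℝ] ℝ}

theorem IsTri.mul {A B : V →L[ℝ] V} {a c a' c' : ℝ} (hA : IsTri e ξ A a c)
    (hB : IsTri e ξ B a' c') : IsTri e ξ (A * B) (a * a') (c * c') := by
  refine ⟨?_, fun x => ?_⟩
  · rw [mul_apply_eq_comp, hB.1, map_smul, hA.1, smul_smul, mul_comm]
  · rw [mul_apply_eq_comp, hA.2, hB.2, mul_assoc]

theorem isTri_smul_one (a : ℝ) : IsTri e ξ (a • 1) a a :=
  ⟨by simp, fun x => by simp⟩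

theorem IsTri.one : IsTri e ξ 1 1 1 := by simpa using isTri_smul_one (e := e) (ξ := ξ) 1

theorem IsTri.left_ne_zero {A : V →L[ℝ] V} {a c : ℝ} (hA : IsTri e ξ A a c) (hU : IsUnit A)
    (he : e ≠ 0) : a ≠ 0 := by
  obtain ⟨U, rfl⟩ := hU
  rintro rfl
  have h1 := congrArg (↑U⁻¹ : V →L[ℝ] V) hA.1
  rw [zero_smul, map_zero, ← mul_apply_eq_comp, Units.inv_mul] at h1
  exact he h1

theorem IsTri.right_ne_zero {A : V →L[ℝ] V} {a c : ℝ} (hA : IsTri e ξ A a c) (hU : IsUnit A)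
    (hξ : ξ ≠ 0) : c ≠ 0 := by
  obtain ⟨U, rfl⟩ := hU
  rintro rfl
  refine hξ (ContinuousLinearMap.ext fun x => ?_)
  have h1 := hA.2 ((↑U⁻¹ : V →L[ℝ] V) x)
  rw [← mul_apply_eq_comp, Units.mul_inv, zero_mul] at h1
  exact h1

/-- The map `1 - A` is onto, and `ξ` would vanish on its range if `c` were `1`. Hence the induced
map of the quotient has a single fixed value. -/
theorem IsTri.ne_one [CompleteSpace V] {A : V →L[ℝ] V} {a c : ℝ} (hA : IsTri e ξ A a c)
    (hA1 : ‖A‖ < 1) (hξ : ξ ≠ 0) : c ≠ 1 := by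
  rintro rfl
  obtain ⟨U, hU⟩ := isUnit_one_sub_of_norm_lt_one hA1
  refine hξ (ContinuousLinearMap.ext fun x => ?_)
  have h1 : (1 - A) ((↑U⁻¹ : V →L[ℝ] V) x) = x := by
    rw [← hU, ← mul_apply_eq_comp, Units.mul_inv]; rfl
  rw [← h1, sub_apply, map_sub, hA.2, one_apply_eq_self]
  simp

/-- Two triangular maps with the same diagonal differ by a multiple of `e ⊗ ξ`. -/
theorem IsTri.sub_eq (hξ : ξ ≠ 0) (hker : ∀ x, ξ x = 0 → ∃ s : ℝ, x = s • e)
    {A B : V →L[ℝ] V} {a c : ℝ} (hA : IsTri e ξ A a c) (hB : IsTri e ξ B a c) :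
    ∃ b : ℝ, A - B = b • ξ.smulRight e := by
  obtain ⟨x₁, hx₁⟩ : ∃ x, ξ x ≠ 0 := by
    by_contra hcon
    push Not at hcon
    exact hξ (ContinuousLinearMap.ext hcon)
  obtain ⟨b, hb⟩ := hker ((A - B) x₁) (by
    rw [sub_apply, map_sub, hA.2, hB.2, sub_self])
  have he : (A - B) e = 0 := by rw [sub_apply, hA.1, hB.1, sub_self]
  refine ⟨(ξ x₁)⁻¹ * b, ContinuousLinearMap.ext fun x => ?_⟩
  obtain ⟨s, hs⟩ := hker (x - (ξ x * (ξ x₁)⁻¹) • x₁) (by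
    rw [map_sub, map_smul, smul_eq_mul, mul_assoc, inv_mul_cancel₀ hx₁, mul_one, sub_self])
  have hx : x = (ξ x * (ξ x₁)⁻¹) • x₁ + s • e := by rw [← hs]; abel
  conv_lhs => rw [hx]
  rw [map_add, map_smul, map_smul, he, hb, smul_zero, add_zero, smul_apply,
    ContinuousLinearMap.smulRight_apply, smul_smul, smul_smul]
  congr 1
  ring

/-- The vectors `e` and `z` span the space, the kernel of `ξ` lying in the line of `e`. -/
theorem eq_zero_of_inner_eq_zero (hker : ∀ x, ξ x = 0 → ∃ s : ℝ, x = s • e) {y z : V}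
    (hye : ⟪y, e⟫_ℝ = 0) (hyz : ⟪y, z⟫_ℝ = 0) (hz : ξ z ≠ 0) : y = 0 := by
  obtain ⟨s, hs⟩ := hker (y - (ξ y * (ξ z)⁻¹) • z) (by
    rw [map_sub, map_smul, smul_eq_mul, mul_assoc, inv_mul_cancel₀ hz, mul_one, sub_self])
  have hy : y = (ξ y * (ξ z)⁻¹) • z + s • e := by rw [← hs]; abel
  refine inner_self_eq_zero (𝕜 := ℝ).1 ?_
  conv_lhs => rw [hy]
  rw [real_inner_comm, inner_add_right, inner_smul_right, inner_smul_right, ← hy, hyz, hye]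
  simp

variable {ι : Type*} {φ : ι → AffEnd V} {E : Set V}

theorem exists_isTri {a c : ι → ℝ} (htri : ∀ i, IsTri e ξ (φ i).lin (a i) (c i)) {g : AffEnd V}
    (hg : g ∈ monoid φ) : ∃ a' c' : ℝ, IsTri e ξ g.lin a' c' := by
  induction hg using Submonoid.closure_induction with
  | mem g hg => obtain ⟨i, rfl⟩ := hg; exact ⟨_, _, htri i⟩
  | one => exact ⟨1, 1, IsTri.one⟩
  | mul f g _ _ hf hg =>
    obtain ⟨a, c, h1⟩ := hf
    obtain ⟨a', c', h2⟩ := hg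
    exact ⟨_, _, h1.mul h2⟩

theorem exists_isTri_of_le {a c : ι → ℝ} (htri : ∀ i, IsTri e ξ (φ i).lin (a i) (c i))
    (hle : ∀ i, |c i| ≤ |a i|) {g : AffEnd V} (hg : g ∈ monoid φ) :
    ∃ a' c' : ℝ, IsTri e ξ g.lin a' c' ∧ |c'| ≤ |a'| := by
  induction hg using Submonoid.closure_induction with
  | mem g hg => obtain ⟨i, rfl⟩ := hg; exact ⟨_, _, htri i, hle i⟩
  | one => exact ⟨1, 1, IsTri.one, le_rfl⟩
  | mul f g _ _ hf hg =>
    obtain ⟨a, c, h1, h3⟩ := hf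
    obtain ⟨a', c', h2, h4⟩ := hg
    refine ⟨_, _, h1.mul h2, ?_⟩
    rw [abs_mul, abs_mul]
    gcongr

theorem exists_isTri_of_eq {a c : ι → ℝ} (htri : ∀ i, IsTri e ξ (φ i).lin (a i) (c i))
    (heq : ∀ i, |c i| = |a i|) {g : AffEnd V} (hg : g ∈ monoid φ) :
    ∃ a' c' : ℝ, IsTri e ξ g.lin a' c' ∧ |c'| = |a'| := by
  induction hg using Submonoid.closure_induction with
  | mem g hg => obtain ⟨i, rfl⟩ := hg; exact ⟨_, _, htri i, heq i⟩
  | one => exact ⟨1, 1, IsTri.one, rfl⟩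
  | mul f g _ _ hf hg =>
    obtain ⟨a, c, h1, h3⟩ := hf
    obtain ⟨a', c', h2, h4⟩ := hg
    refine ⟨_, _, h1.mul h2, ?_⟩
    rw [abs_mul, abs_mul, h3, h4]

theorem IsTri.apply_sub {f : AffEnd V} {a c : ℝ} (hf : IsTri e ξ f.lin a c) (x y : V) :
    ξ (f x) - ξ (f y) = c * (ξ x - ξ y) := by
  rw [← map_sub, AffEnd.apply_sub_apply, hf.2, map_sub]

/-- Maps with different fixed values on the quotient do not commute on the quotient. -/
theorem IsTri.apply_mul_ne {f g : AffEnd V} {a c a' c' : ℝ} (hf : IsTri e ξ f.lin a c)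
    (hg : IsTri e ξ g.lin a' c') (hc' : c' ≠ 1) {q : V} (hgq : ξ (g q) = ξ q)
    (hfq : ξ (f q) ≠ ξ q) (x : V) : ξ ((f * g) x) ≠ ξ ((g * f) x) := by
  intro heq
  rw [AffEnd.mul_apply, AffEnd.mul_apply] at heq
  have h1 := hf.apply_sub (g x) (g q)
  have h2 := hg.apply_sub x q
  have h3 := hg.apply_sub (f x) (f q)
  have h4 := hf.apply_sub x q
  have h5 := hf.apply_sub (g q) q
  have h6 := hg.apply_sub (f q) q
  -- On the quotient `f * g` and `g * f` have the same slope, so agreement at one point is agreement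
  -- everywhere. Then `g` would fix the value `ξ (f q)` as well as `ξ q`, impossible for a slope `c'
  -- ≠ 1`.
  have h7 : (1 - c') * (ξ (f q) - ξ q) = 0 := by
    rw [hgq] at *
    linear_combination heq - h1 - c * h2 + h3 + c' * h4 + h6 - h5
  rcases mul_eq_zero.1 h7 with h8 | h8
  · exact hc' (by linarith)
  · exact hfq (by linarith)

variable [FiniteDimensional ℝ V]

/-- A triangular system with non-commuting linear parts contains two maps whose linear parts do
not commute and which do not commute on the quotient. -/
theorem IsSystem.exists_noncommuting (h : IsSystem φ E) {a c : ι → ℝ}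
    (htri : ∀ i, IsTri e ξ (φ i).lin (a i) (c i)) (hξ : ξ ≠ 0)
    (hnc : ∃ i j, (φ i).lin * (φ j).lin ≠ (φ j).lin * (φ i).lin) :
    ∃ f ∈ monoid φ, ∃ g ∈ monoid φ, f.lin * g.lin ≠ g.lin * f.lin ∧
      ∀ x, ξ ((f * g) x) ≠ ξ ((g * f) x) := by
  obtain ⟨i, j, hij⟩ := hnc
  have hmem := fun i : ι => IsSystem.mem_monoid (φ := φ) i
  have hc1 : ∀ i, c i ≠ 1 := fun i => (htri i).ne_one (h.norm_gen_lt i) hξ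
  obtain ⟨q, hq⟩ := AffEnd.exists_fixed (φ i) (h.norm_gen_lt i)
  have hqi : ξ (φ i q) = ξ q := by rw [hq]
  by_cases hqj : ξ (φ j q) = ξ q
  swap
  · exact ⟨φ j, hmem j, φ i, hmem i, hij.symm,
      fun x => (htri j).apply_mul_ne (htri i) (hc1 i) hqi hqj x⟩
  -- Now `φ i` and `φ j` fix the same value on the quotient. Some third map moves it, since
  -- otherwise `ξ` would be constant on the orbit of `q`.
  obtain ⟨k, hk⟩ : ∃ k, ξ (φ k q) ≠ ξ q := by
    by_contra hcon
    push Not at hcon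
    have hall : ∀ g ∈ monoid φ, ξ (g q) = ξ q := by
      intro g hg
      induction hg using Submonoid.closure_induction with
      | mem g hg => obtain ⟨i, rfl⟩ := hg; exact hcon i
      | one => rw [AffEnd.one_apply]
      | mul f g hf' _ hf hg =>
        obtain ⟨a', c', h1⟩ := exists_isTri htri hf'
        have := h1.apply_sub (g q) q
        rw [hg, sub_self, mul_zero, sub_eq_zero] at this
        rw [AffEnd.mul_apply, this, hf]
    obtain ⟨y, hy⟩ := (InnerProductSpace.toDual ℝ V).surjective ξ
    have hξy : ∀ x, ξ x = ⟪y, x⟫_ℝ := fun x => by rw [← hy]; rfl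
    have hy0 : y ≠ 0 := fun h0 => hξ (by rw [← hy, h0, map_zero])
    obtain ⟨g, hg, hne⟩ := h.exists_inner_ne q hy0
    rw [← hξy, ← hξy] at hne
    exact hne (hall g hg)
  by_cases hki : (φ k).lin * (φ i).lin = (φ i).lin * (φ k).lin
  swap
  · exact ⟨φ k, hmem k, φ i, hmem i, hki, fun x => (htri k).apply_mul_ne (htri i) (hc1 i) hqi hk x⟩
  by_cases hkj : (φ k).lin * (φ j).lin = (φ j).lin * (φ k).lin
  swap
  · exact ⟨φ k, hmem k, φ j, hmem j, hkj, fun x => (htri k).apply_mul_ne (htri j) (hc1 j) hqj hk x⟩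
  -- The linear part of `φ k` commutes with both others, so `φ i * φ k` inherits from `φ i` the
  -- failure to commute with `φ j` and from `φ k` that it moves the value `ξ q`.
  refine ⟨φ i * φ k, mul_mem (hmem i) (hmem k), φ j, hmem j, fun heq => hij ?_,
    fun x => IsTri.apply_mul_ne ((htri i).mul (htri k)) (htri j) (hc1 j) hqj ?_ x⟩
  · rw [AffEnd.mul_lin, mul_assoc, hkj, ← mul_assoc, ← mul_assoc] at heq
    exact (h.isUnit k).mul_right_cancel heq
  · have h1 := (htri i).apply_sub (φ k q) q
    rw [AffEnd.mul_apply]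
    intro h2
    rw [h2, hqi, sub_self] at h1
    have h4 : c i ≠ 0 := (htri i).right_ne_zero (h.isUnit i) hξ
    rcases mul_eq_zero.1 h1.symm with h6 | h6
    · exact h4 h6
    · exact hk (by linarith)

/-- Triangular systems in which the invariant line is strictly dominated by the quotient for some
map. -/
theorem IsSystem.thick_of_tri_quotient (h : IsSystem φ E) {a c : ι → ℝ}
    (htri : ∀ i, IsTri e ξ (φ i).lin (a i) (c i)) (hξ : ξ ≠ 0)
    (hker : ∀ x, ξ x = 0 → ∃ s : ℝ, x = s • e) (hξe : ξ e = 0)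
    (hnc : ∃ i j, (φ i).lin * (φ j).lin ≠ (φ j).lin * (φ i).lin)
    {i : ι} (hi : |a i| < |c i|) :
    ∃ n : ℕ, 1 ≤ n ∧ (interior (n • E)).Nonempty := by
  obtain ⟨x₁, hx₁⟩ : ∃ x, ξ x ≠ 0 := by
    by_contra hcon
    push Not at hcon
    exact hξ (ContinuousLinearMap.ext hcon)
  have hci : c i ≠ 0 := fun h0 => by
    rw [h0, abs_zero] at hi; exact absurd hi (not_lt.2 (abs_nonneg _))
  have hca : c i - a i ≠ 0 := fun h0 => by rw [sub_eq_zero.1 h0] at hi; exact lt_irrefl _ hi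
  obtain ⟨u, hξu, hu⟩ : ∃ u, ξ u = 1 ∧ (φ i).lin u = c i • u := by
    obtain ⟨x₀, hξx₀⟩ : ∃ x₀, ξ x₀ = 1 :=
      ⟨(ξ x₁)⁻¹ • x₁, by rw [map_smul, smul_eq_mul, inv_mul_cancel₀ hx₁]⟩
    obtain ⟨b, hb⟩ := hker ((φ i).lin x₀ - c i • x₀) (by
      rw [map_sub, (htri i).2, map_smul, smul_eq_mul, sub_self])
    refine ⟨x₀ + (b / (c i - a i)) • e, by simp [hξx₀, hξe], ?_⟩
    rw [map_add, map_smul, (htri i).1, sub_eq_iff_eq_add.1 hb, smul_add, smul_smul, smul_smul,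
      add_comm (b • e), add_assoc, ← add_smul]
    congr 2
    field_simp
    ring
  set P : V →L[ℝ] V := ξ.smulRight u with hP
  have hpow : ∀ k : ℕ, (φ i).lin ^ k = c i ^ k • P + a i ^ k • (1 - P) := by
    intro k
    induction k with
    | zero => simp
    | succ k ih =>
      have e1 : (φ i).lin * P = c i • P := by
        ext1 x
        rw [mul_apply_eq_comp, hP, ContinuousLinearMap.smulRight_apply, map_smul, hu, smul_apply,
          ContinuousLinearMap.smulRight_apply, smul_comm]
      have e2 : (φ i).lin * (1 - P) = a i • (1 - P) := by
        ext1 x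
        obtain ⟨s, hs⟩ := hker ((1 - P) x) (by
          simp [hP, hξu])
        rw [mul_apply_eq_comp, smul_apply, hs, map_smul, (htri i).1, smul_comm]
      rw [pow_succ', ih, mul_add, mul_smul_comm, mul_smul_comm, e1, e2, smul_smul, smul_smul,
        pow_succ, pow_succ]
  refine h.thick_of_proximal (IsSystem.mem_monoid i) (h.norm_gen_lt i) hci (u := u) (w := ξ) hξu
    ?_ ?_
  · have h1 : Tendsto (fun k : ℕ => P + (a i / c i) ^ k • (1 - P)) atTop (𝓝 P) := by
      have h2 : Tendsto (fun k : ℕ => (a i / c i) ^ k) atTop (𝓝 0) :=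
        tendsto_pow_atTop_nhds_zero_of_abs_lt_one (by
          rw [abs_div]; exact (div_lt_one (abs_pos.2 hci)).2 hi)
      simpa using (h2.smul_const (1 - P)).const_add P
    refine h1.congr fun k => ?_
    rw [hpow, smul_add, smul_smul, smul_smul, inv_mul_cancel₀ (pow_ne_zero _ hci), one_smul,
      div_pow, inv_mul_eq_div]
  -- If the orbit of `u` does not span, `u` is an eigenvector of all linear parts. So is `e`, and
  -- the linear parts are then simultaneously diagonal, against `hnc`.
  · refine eq_top_of_forall_inner fun y hy => ?_
    have hyu : ⟪y, u⟫_ℝ = 0 := hy u ⟨1, one_mem _, rfl⟩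
    by_contra hy0
    have hye : ⟪y, e⟫_ℝ ≠ 0 := fun h0 =>
      hy0 (eq_zero_of_inner_eq_zero hker h0 hyu (by rw [hξu]; exact one_ne_zero))
    have hju : ∀ j, (φ j).lin u = c j • u := by
      intro j
      obtain ⟨b, hb⟩ := hker ((φ j).lin u - c j • u) (by
        rw [map_sub, (htri j).2, map_smul, smul_eq_mul, sub_self])
      have h1 := hy _ ⟨φ j, IsSystem.mem_monoid j, rfl⟩
      rw [sub_eq_iff_eq_add.1 hb, inner_add_right, inner_smul_right, inner_smul_right, hyu,
        mul_zero,
        add_zero] at h1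
      rw [(mul_eq_zero.1 h1).resolve_right hye, zero_smul] at hb
      exact sub_eq_zero.1 hb
    obtain ⟨j, k, hjk⟩ := hnc
    refine hjk (ContinuousLinearMap.ext fun x => ?_)
    obtain ⟨s, hs⟩ := hker (x - ξ x • u) (by simp [hξu])
    have hx : x = ξ x • u + s • e := by rw [← hs]; abel
    rw [hx]
    simp only [mul_apply_eq_comp, map_add, map_smul, hju, (htri _).1, smul_smul]
    ring_nf

/-- Triangular systems in which the quotient is dominated by the invariant line. -/
theorem IsSystem.thick_of_tri_line (h : IsSystem φ E) {a c : ι → ℝ}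
    (htri : ∀ i, IsTri e ξ (φ i).lin (a i) (c i)) (he : e ≠ 0) (hξ : ξ ≠ 0)
    (hker : ∀ x, ξ x = 0 → ∃ s : ℝ, x = s • e) (hξe : ξ e = 0)
    (hnc : ∃ i j, (φ i).lin * (φ j).lin ≠ (φ j).lin * (φ i).lin)
    (hle : ∀ i, |c i| ≤ |a i|) {i : ι} (hi : |c i| < |a i|) :
    ∃ n : ℕ, 1 ≤ n ∧ (interior (n • E)).Nonempty := by
  obtain ⟨f, hf, g, hg, hfg, hfgx⟩ := h.exists_noncommuting htri hξ hnc
  obtain ⟨af, cf, htf, hlf⟩ := exists_isTri_of_le htri hle hf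
  obtain ⟨ag, cg, htg, hlg⟩ := exists_isTri_of_le htri hle hg
  obtain ⟨α, hα⟩ : ∃ α, α = a i * (af * ag) := ⟨_, rfl⟩
  obtain ⟨γ, hγ⟩ : ∃ γ, γ = c i * (cf * cg) := ⟨_, rfl⟩
  -- Two words in the same letters have equal diagonals, yet differ both in their shear and on the
  -- quotient. The factor `φ i` makes the domination `|γ| < |α|` strict.
  set f₁ : Bool → AffEnd V := fun b => if b then φ i * (f * g) else φ i * (g * f) with hf₁
  have hmem : ∀ b, f₁ b ∈ monoid φ := by
    rintro (_ | _)
    exacts [mul_mem (IsSystem.mem_monoid i) (mul_mem hg hf),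
      mul_mem (IsSystem.mem_monoid i) (mul_mem hf hg)]
  have htri₁ : ∀ b, IsTri e ξ (f₁ b).lin α γ := by
    rintro (_ | _)
    · have := (htri i).mul (htg.mul htf)
      rw [mul_comm ag, mul_comm cg, ← hα, ← hγ] at this
      exact this
    · rw [hα, hγ]
      exact (htri i).mul (htf.mul htg)
  have hlt₁ : ∀ b, ‖(f₁ b).lin‖ < 1 := by
    have : ∀ k ∈ monoid φ, ‖(φ i * k).lin‖ < 1 := fun k hk => by
      rw [AffEnd.mul_lin]
      exact (norm_mul_le _ _).trans_lt ((mul_le_of_le_one_right (norm_nonneg _)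
        (h.norm_le_one hk)).trans_lt (h.norm_gen_lt i))
    rintro (_ | _)
    exacts [this _ (mul_mem hg hf), this _ (mul_mem hf hg)]
  have hα0 : α ≠ 0 := (htri₁ true).left_ne_zero (h.isUnit_lin (hmem true)) he
  have hγα : |γ| < |α| := by
    have h1 : 0 < |af * ag| := abs_pos.2 fun h0 => hα0 (by rw [hα, h0, mul_zero])
    rw [hα, hγ, abs_mul, abs_mul (a i)]
    have h2 : |cf * cg| ≤ |af * ag| := by rw [abs_mul, abs_mul]; gcongr
    calc |c i| * |cf * cg| ≤ |c i| * |af * ag| := by gcongr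
      _ < |a i| * |af * ag| := by gcongr
  set n : V →L[ℝ] V := ξ.smulRight e with hn
  have hnn : n * n = 0 := by ext1 x; simp [hn, mul_apply_eq_comp, hξe]
  obtain ⟨b, hb⟩ := IsTri.sub_eq hξ hker (htri₁ true) (htri₁ false)
  have hb0 : b ≠ 0 := by
    rintro rfl
    rw [zero_smul] at hb
    have h1 : (φ i).lin * (f.lin * g.lin) = (φ i).lin * (g.lin * f.lin) := sub_eq_zero.1 hb
    exact hfg ((h.isUnit i).mul_left_cancel h1)
  have hdiff : ∀ x, ξ (f₁ true x - f₁ false x) ≠ 0 := by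
    intro x
    have e1 : f₁ true x - f₁ false x = (φ i).lin ((f * g) x - (g * f) x) := by
      simp only [hf₁, if_true, Bool.false_eq_true, if_false]
      rw [AffEnd.mul_apply (φ i), AffEnd.mul_apply (φ i), AffEnd.apply_sub_apply]
    rw [e1, (htri i).2, map_sub]
    exact mul_ne_zero ((htri i).right_ne_zero (h.isUnit i) hξ) (sub_ne_zero.2 (hfgx x))
  -- Words of length two exhibit `f₁ true x - f₁ false x` at the two points `x = f₁ t o`. Each of
  -- these vectors is transversal to `e`, and their difference is a non-zero multiple of `e`, so
  -- both directions are seen.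
  set F : Bool × Bool → AffEnd V := fun s => f₁ s.1 * f₁ s.2 with hF
  set D : V →L[ℝ] V := (f₁ true).lin * (f₁ true).lin with hD
  have htD : IsTri e ξ D (α * α) (γ * γ) := (htri₁ true).mul (htri₁ true)
  have hDn : D * n = (α * α) • n := by
    ext1 x
    rw [mul_apply_eq_comp, hn, ContinuousLinearMap.smulRight_apply, map_smul, htD.1, smul_apply,
      ContinuousLinearMap.smulRight_apply, smul_comm]
  have hnD : n * D = (γ * γ) • n := by
    ext1 x
    rw [mul_apply_eq_comp, hn, ContinuousLinearMap.smulRight_apply, htD.2, smul_apply,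
      ContinuousLinearMap.smulRight_apply, mul_smul]
  choose bs hbs using fun s : Bool × Bool =>
    IsTri.sub_eq hξ hker ((htri₁ s.1).mul (htri₁ s.2)) htD
  have hFD : ∀ s, (F s).lin = D + bs s • n := fun s => by
    rw [hF, AffEnd.mul_lin, ← sub_eq_iff_eq_add'.1 (hbs s)]
  set θ := max ‖(f₁ true).lin‖ ‖(f₁ false).lin‖ with hθ
  have hθ1 : θ < 1 := max_lt (hlt₁ true) (hlt₁ false)
  have hFθ : ∀ s, ‖(F s).lin‖ ≤ θ := by
    rintro ⟨s, s'⟩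
    have h1 : ‖(f₁ s).lin‖ ≤ θ := by
      cases s
      exacts [le_max_right _ _, le_max_left _ _]
    exact (norm_mul_le _ _).trans
      ((mul_le_of_le_one_right (norm_nonneg _) (h.norm_le_one (hmem s'))).trans h1)
  obtain ⟨o, ho⟩ := AffEnd.exists_barycentre F hθ1 hFθ
  obtain ⟨δ, hδ, hδF⟩ := exists_pos_le_sum_abs_inner (fun s => F s o - o) (by
    intro y hy
    have h1 : ∀ t, ⟪y, f₁ true (f₁ t o) - f₁ false (f₁ t o)⟫_ℝ = 0 := by
      intro t
      have e1 : f₁ true (f₁ t o) - f₁ false (f₁ t o) =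
          (F (true, t) o - o) - (F (false, t) o - o) := by
        rw [hF, AffEnd.mul_apply, AffEnd.mul_apply]; abel
      rw [e1, inner_sub_right, hy, hy, sub_zero]
    refine eq_zero_of_inner_eq_zero hker ?_ (h1 true) (hdiff _)
    have e2 : (f₁ true (f₁ true o) - f₁ false (f₁ true o)) -
        (f₁ true (f₁ false o) - f₁ false (f₁ false o)) =
          (b * ξ (f₁ true o - f₁ false o)) • e := by
      have e3 : (f₁ true (f₁ true o) - f₁ false (f₁ true o)) -
        (f₁ true (f₁ false o) - f₁ false (f₁ false o)) =
          ((f₁ true).lin - (f₁ false).lin) (f₁ true o - f₁ false o) := by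
        rw [sub_apply, ← AffEnd.apply_sub_apply, ← AffEnd.apply_sub_apply]; abel
      rw [e3, hb, smul_apply, ContinuousLinearMap.smulRight_apply, smul_smul]
    have e4 := congrArg (fun x => ⟪y, x⟫_ℝ) e2
    rw [inner_sub_right, h1, h1, sub_zero, inner_smul_right] at e4
    exact (mul_eq_zero.1 e4.symm).resolve_left (mul_ne_zero hb0 (hdiff o)))
  have hα2 : 0 < α * α := mul_self_pos.2 hα0
  have hγα2 : γ * γ < α * α := by
    rw [← abs_mul_abs_self γ, ← abs_mul_abs_self α]
    gcongr
  set bm := ∑ s, |bs s| with hbm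
  -- The fixed point of `β ↦ (γ ^ 2 * β + bm) / α ^ 2`, which bounds how the shear relative to `D ^
  -- k` evolves under one more factor; it exists because `γ ^ 2 < α ^ 2`.
  set β₀ := bm / (α * α - γ * γ) with hβ₀
  have hgap : 0 < α * α - γ * γ := by linarith
  have hβ₀0 : 0 ≤ β₀ := by positivity
  refine thick_of_frame h.compact h.nonempty F
    (fun s => h.mapsTo (mul_mem (hmem s.1) (hmem s.2))) D ?_ ?_
    (fun k => {A | ∃ β : ℝ, |β| ≤ β₀ ∧ A = D ^ k * (1 + β • n)}) ⟨0, by simpa, by simp⟩ ?_ ho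
    (δ := δ / (1 + β₀ * ‖n‖)) (C := ‖(1 : V →L[ℝ] V)‖ + β₀ * ‖n‖) (by positivity) ?_
  · exact (norm_mul_le _ _).trans_lt ((mul_le_of_le_one_right (norm_nonneg _)
      (hlt₁ true).le).trans_lt (hlt₁ true))
  · exact (h.isUnit_lin (hmem true)).mul (h.isUnit_lin (hmem true))
  · rintro k A ⟨β, hβ, rfl⟩ s
    refine ⟨(α * α)⁻¹ * (β * (γ * γ) + bs s), ?_, ?_⟩
    · rw [abs_mul, abs_inv, abs_of_pos hα2, inv_mul_le_iff₀ hα2]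
      have h1 : |bs s| ≤ bm := Finset.single_le_sum (f := fun s => |bs s|)
        (fun _ _ => abs_nonneg _) (Finset.mem_univ s)
      have h2 : |β * (γ * γ) + bs s| ≤ β₀ * (γ * γ) + bm := by
        refine (abs_add_le _ _).trans ?_
        rw [abs_mul, abs_mul_self]
        have := mul_self_nonneg γ
        gcongr
      refine h2.trans (le_of_eq ?_)
      have h3 : β₀ * (α * α - γ * γ) = bm := div_mul_cancel₀ _ hgap.ne'
      linarith
    · rw [hFD, pow_succ, mul_assoc, mul_assoc]
      congr 1
      simp only [mul_add, add_mul, one_mul, mul_one, smul_mul_assoc, mul_smul_comm, hnD, hDn, hnn,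
        smul_zero, add_zero]
      rw [smul_smul, smul_smul, ← mul_add, mul_right_comm, inv_mul_cancel₀ hα2.ne', one_mul,
        add_smul]
      abel
  · rintro k A ⟨β, hβ, rfl⟩
    refine ⟨1 + β • n, rfl, ?_, fun y => ?_⟩
    · refine (norm_add_le _ _).trans ?_
      rw [norm_smul, Real.norm_eq_abs]
      gcongr
    · set U : V →L[ℝ] V := 1 + β • n with hU
      have h1 : U * (1 - β • n) = 1 := by
        rw [hU]
        simp only [mul_sub, add_mul, one_mul, mul_one, smul_mul_assoc, mul_smul_comm, hnn,
          smul_zero,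
          add_zero]
        abel
      have h2 : ‖y‖ ≤ (1 + β₀ * ‖n‖) * ‖ContinuousLinearMap.adjoint U y‖ := by
        have e1 : y = ContinuousLinearMap.adjoint (1 - β • n)
            (ContinuousLinearMap.adjoint U y) := by
          refine ext_inner_right ℝ fun x => ?_
          rw [ContinuousLinearMap.adjoint_inner_left, ContinuousLinearMap.adjoint_inner_left,
            ← mul_apply_eq_comp, h1, one_apply_eq_self]
        calc ‖y‖ = ‖ContinuousLinearMap.adjoint (1 - β • n) (ContinuousLinearMap.adjoint U y)‖ := by
              rw [← e1]
          _ ≤ ‖1 - β • n‖ * ‖ContinuousLinearMap.adjoint U y‖ := by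
              refine (ContinuousLinearMap.le_opNorm _ _).trans ?_
              rw [LinearIsometryEquiv.norm_map]
          _ ≤ _ := by
              gcongr
              refine (norm_sub_le _ _).trans ?_
              rw [norm_smul, Real.norm_eq_abs]
              gcongr
              exact ContinuousLinearMap.norm_id_le
      have h3 := hδF (ContinuousLinearMap.adjoint U y)
      simp only [ContinuousLinearMap.adjoint_inner_left] at h3
      refine le_trans ?_ h3
      rw [div_mul_eq_mul_div, div_le_iff₀ (by positivity)]
      calc δ * ‖y‖ ≤ δ * ((1 + β₀ * ‖n‖) * ‖ContinuousLinearMap.adjoint U y‖) := by gcongr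
        _ = _ := by ring

/-- Triangular systems in which the invariant line and the quotient are equally contracted. -/
theorem IsSystem.thick_of_tri_balanced (h : IsSystem φ E) {a c : ι → ℝ}
    (htri : ∀ i, IsTri e ξ (φ i).lin (a i) (c i)) (hξ : ξ ≠ 0)
    (hker : ∀ x, ξ x = 0 → ∃ s : ℝ, x = s • e)
    (hnc : ∃ i j, (φ i).lin * (φ j).lin ≠ (φ j).lin * (φ i).lin)
    (heq : ∀ i, |c i| = |a i|) :
    ∃ n : ℕ, 1 ≤ n ∧ (interior (n • E)).Nonempty := by
  obtain ⟨f, hf, g, hg, hfg, hfgx⟩ := h.exists_noncommuting htri hξ hnc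
  obtain ⟨af, cf, htf, hef⟩ := exists_isTri_of_eq htri heq hf
  obtain ⟨ag, cg, htg, heg⟩ := exists_isTri_of_eq htri heq hg
  obtain ⟨i⟩ := h.index_nonempty
  -- Linear parts in `S` are a scalar plus a multiple of the one operator `ξ.smulRight e`, so they
  -- commute.
  set S : Submonoid (AffEnd V) :=
    { carrier := {k | k ∈ monoid φ ∧ ∃ a : ℝ, IsTri e ξ k.lin a a}
      one_mem' := ⟨one_mem _, 1, IsTri.one⟩
      mul_mem' := fun h1 h2 => ⟨mul_mem h1.1 h2.1, by
        obtain ⟨-, a, ha⟩ := h1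
        obtain ⟨-, b, hb⟩ := h2
        exact ⟨a * b, ha.mul hb⟩⟩ } with hS
  have hcomm : ∀ k ∈ S, ∀ k' ∈ S, k.lin * k'.lin = k'.lin * k.lin := by
    rintro k ⟨-, a, ha⟩ k' ⟨-, b, hb⟩
    obtain ⟨s, hs⟩ := IsTri.sub_eq hξ hker ha (isTri_smul_one a)
    obtain ⟨t, ht⟩ := IsTri.sub_eq hξ hker hb (isTri_smul_one b)
    rw [sub_eq_iff_eq_add.1 hs, sub_eq_iff_eq_add.1 ht]
    simp only [mul_add, add_mul, smul_mul_assoc, mul_smul_comm, one_mul, mul_one, smul_add,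
      smul_smul]
    rw [mul_comm t s, mul_comm b s, mul_comm t a, mul_comm b a]
    abel
  have hsq : ∀ {x y : ℝ}, |x| = |y| → x * x = y * y := fun {x y} hxy => by
    rw [← abs_mul_abs_self x, hxy, abs_mul_abs_self]
  -- Doubling the words squares the diagonal entries, which turns equality of moduli into equality.
  set f₁ := f * g * (f * g) with hf₁
  set f₂ := f * g * (g * f) with hf₂
  have hq : cf * cg * (cf * cg) = af * ag * (af * ag) :=
    hsq (by rw [abs_mul, abs_mul, hef, heg])
  have ht₁ : IsTri e ξ f₁.lin (af * ag * (af * ag)) (af * ag * (af * ag)) := by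
    have := (htf.mul htg).mul (htf.mul htg)
    rwa [hq] at this
  have ht₂ : IsTri e ξ f₂.lin (af * ag * (af * ag)) (af * ag * (af * ag)) := by
    have := (htf.mul htg).mul (htg.mul htf)
    rwa [mul_comm cg, mul_comm ag, hq] at this
  have hm₁ : f₁ ∈ S := ⟨mul_mem (mul_mem hf hg) (mul_mem hf hg), _, ht₁⟩
  have hm₂ : f₂ ∈ S := ⟨mul_mem (mul_mem hf hg) (mul_mem hg hf), _, ht₂⟩
  have hm₀ : φ i * φ i ∈ S := by
    refine ⟨mul_mem (IsSystem.mem_monoid i) (IsSystem.mem_monoid i), a i * a i, ?_⟩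
    have := (htri i).mul (htri i)
    rwa [hsq (heq i)] at this
  obtain ⟨b, hb⟩ := IsTri.sub_eq hξ hker ht₁ ht₂
  have hb0 : b ≠ 0 := by
    rintro rfl
    rw [zero_smul] at hb
    have h1 : (f * g).lin * (f.lin * g.lin) = (f * g).lin * (g.lin * f.lin) := sub_eq_zero.1 hb
    exact hfg ((h.isUnit_lin (mul_mem hf hg)).mul_left_cancel h1)
  have hlin : (f₁ * f₂).lin = (f₂ * f₁).lin := hcomm _ hm₁ _ hm₂
  set d := (f₁ * f₂).tr - (f₂ * f₁).tr with hd
  have hd0 : d = (f₁ * f₂) 0 - (f₂ * f₁) 0 := by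
    rw [AffEnd.apply_def, AffEnd.apply_def, map_zero, map_zero, zero_add, zero_add]
  -- On the quotient `f₁` and `f₂` have a common slope other than `1` and different translations, so
  -- they do not commute there.
  have hξd : ξ d ≠ 0 := by
    have hf1 : ‖f.lin‖ < 1 := (h.eq_one_or_norm_lt hf).resolve_left fun h0 => hfg (by simp [h0])
    have hf₁1 : ‖f₁.lin‖ < 1 := by
      have : f₁.lin = f.lin * (g * (f * g)).lin := by rw [hf₁, mul_assoc]; rfl
      rw [this]
      exact (norm_mul_le _ _).trans_lt ((mul_le_of_le_one_right (norm_nonneg _)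
        (h.norm_le_one (mul_mem hg (mul_mem hf hg)))).trans_lt hf1)
    have hne1 := ht₁.ne_one hf₁1 hξ
    have hne0 : cf * cg ≠ 0 := (htf.mul htg).right_ne_zero (h.isUnit_lin (mul_mem hf hg)) hξ
    have h12 : ξ (f₁ 0) - ξ (f₂ 0) ≠ 0 := by
      rw [hf₁, hf₂, AffEnd.mul_apply (f * g), AffEnd.mul_apply (f * g),
        IsTri.apply_sub (f := f * g) (htf.mul htg)]
      exact mul_ne_zero hne0 (sub_ne_zero.2 (hfgx 0))
    rw [hd0, AffEnd.mul_apply f₁, AffEnd.mul_apply f₂, map_sub]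
    have h3 := ht₁.apply_sub (f₂ 0) 0
    have h4 := ht₂.apply_sub (f₁ 0) 0
    rw [map_zero] at h3 h4
    intro h5
    have h6 : (1 - af * ag * (af * ag)) * (ξ (f₁ 0) - ξ (f₂ 0)) = 0 := by
      linear_combination h5 - h3 + h4
    rcases mul_eq_zero.1 h6 with h7 | h7
    · exact hne1 (by linarith)
    · exact h12 h7
  refine thick_of_commuting h.compact h.nonempty S (fun k hk => h.mapsTo hk.1)
    (fun k hk => h.norm_le_one hk.1) (fun k hk => h.isUnit_lin hk.1) hcomm hm₀
    ((norm_mul_le _ _).trans_lt ((mul_le_of_le_one_right (norm_nonneg _)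
      (h.norm_gen_lt i).le).trans_lt (h.norm_gen_lt i))) ?_
  refine eq_top_of_forall_inner fun y hy => ?_
  have hyd : ⟪y, d⟫_ℝ = 0 := hy d ⟨_, mul_mem hm₁ hm₂, _, mul_mem hm₂ hm₁, hlin, rfl⟩
  -- Composing on the left with `k` shows that `k.lin d` is also a difference of translations. Hence
  -- the span contains `f₁.lin d - f₂.lin d`, a non-zero multiple of `e`, besides `d`.
  have hyk : ∀ k ∈ S, ⟪y, k.lin d⟫_ℝ = 0 := by
    intro k hk
    refine hy _ ⟨k * (f₁ * f₂), mul_mem hk (mul_mem hm₁ hm₂), k * (f₂ * f₁),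
      mul_mem hk (mul_mem hm₂ hm₁), by rw [AffEnd.mul_lin, hlin, AffEnd.mul_lin k], ?_⟩
    rw [AffEnd.mul_tr k, AffEnd.mul_tr k, hd, map_sub]
    abel
  refine eq_zero_of_inner_eq_zero hker ?_ hyd hξd
  have h1 := congrArg (fun A : V →L[ℝ] V => ⟪y, A d⟫_ℝ) hb
  simp only [sub_apply, inner_sub_right, hyk _ hm₁, hyk _ hm₂, smul_apply,
    ContinuousLinearMap.smulRight_apply, inner_smul_right, sub_zero] at h1
  have h2 : (b * ξ d) * ⟪y, e⟫_ℝ = 0 := by rw [mul_assoc]; exact h1.symm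
  exact (mul_eq_zero.1 h2).resolve_left (mul_ne_zero hb0 hξd)

end Triangular

/-! ### Matrices of size two: trace, determinant and distortion. -/

section Plane

/-- A form of Cayley–Hamilton: in general the two sides differ by `X.det • B.adjugate`. It converts
vanishing traces into vanishing products. -/
theorem mul_mul_self_fin_two (X B : Matrix (Fin 2) (Fin 2) ℝ) (hX : X.det = 0) :
    X * B * X = (X * B).trace • X := by
  have h : X * B * X = (X * B).trace • X - X.det • B.adjugate := by
    rw [Matrix.adjugate_fin_two, Matrix.det_fin_two]
    ext i j
    fin_cases i <;> fin_cases j <;>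
      simp [Matrix.mul_apply, Fin.sum_univ_two, Matrix.trace] <;> ring
  rw [h, hX, zero_smul, sub_zero]

/-- In size two the adjugate is `X.trace • 1 - X`, which is linear in `X`, so its norm is bounded by
a multiple of that of `X`. -/
theorem mul_trace_sub_self_fin_two (X : Matrix (Fin 2) (Fin 2) ℝ) :
    X * (X.trace • 1 - X) = X.det • 1 := by
  rw [Matrix.det_fin_two]
  ext i j
  fin_cases i <;> fin_cases j <;>
    simp [Matrix.mul_apply, Fin.sum_univ_two, Matrix.trace] <;> ring

/-- A real `2 × 2` matrix with large trace has a simple dominant eigenvalue. -/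
theorem hasSimpleDominantEigenvalue_of_trace (X : Matrix (Fin 2) (Fin 2) ℝ)
    (hX : 4 * |X.det| < X.trace ^ 2) : HasSimpleDominantEigenvalue X := by
  -- The discriminant is positive, so the roots are real; the trace is non-zero, so the root on the
  -- side of its sign has the larger modulus.
  obtain ⟨z, w, hsum, hprod, hlt⟩ :
      ∃ z w : ℝ, z + w = X.trace ∧ z * w = X.det ∧ |w| < |z| := by
    set t := X.trace
    set D := X.det
    have hdisc : 0 < t ^ 2 - 4 * D := by linarith [le_abs_self D]
    set s := √(t ^ 2 - 4 * D) with hs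
    have hs0 : 0 < s := Real.sqrt_pos.2 hdisc
    have hss : s * s = t ^ 2 - 4 * D := Real.mul_self_sqrt hdisc.le
    have ht : t ≠ 0 := fun h0 => by
      rw [h0] at hX; nlinarith [abs_nonneg D]
    rcases lt_or_gt_of_ne ht with h | h
    · exact ⟨(t - s) / 2, (t + s) / 2, by ring, by nlinarith, sq_lt_sq.1 (by nlinarith)⟩
    · exact ⟨(t + s) / 2, (t - s) / 2, by ring, by nlinarith, sq_lt_sq.1 (by nlinarith)⟩
  have hzw : (z : ℂ) ≠ w := fun h => by
    rw [Complex.ofReal_injective h] at hlt; exact lt_irrefl _ hlt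
  have hcp : (X.map (algebraMap ℝ ℂ)).charpoly =
      (Polynomial.X - Polynomial.C (z : ℂ)) * (Polynomial.X - Polynomial.C (w : ℂ)) := by
    rw [Matrix.charpoly_map, Matrix.charpoly_fin_two, ← hsum, ← hprod]
    simp
    ring
  have hne : (Polynomial.X - Polynomial.C (z : ℂ)) * (Polynomial.X - Polynomial.C (w : ℂ)) ≠ 0 :=
    mul_ne_zero (Polynomial.X_sub_C_ne_zero _) (Polynomial.X_sub_C_ne_zero _)
  refine ⟨z, ?_, fun v hv hvz => ?_⟩
  · rw [hcp, Polynomial.rootMultiplicity_mul hne, Polynomial.rootMultiplicity_X_sub_C,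
      Polynomial.rootMultiplicity_X_sub_C, if_pos rfl, if_neg hzw]
  · rw [hcp, Polynomial.IsRoot.def, Polynomial.eval_mul] at hv
    have hvw : v = w := by
      rcases mul_eq_zero.1 hv with h | h
      · exact absurd (by simpa [sub_eq_zero] using h) hvz
      · simpa [sub_eq_zero] using h
    rw [hvw, Complex.norm_real, Complex.norm_real]
    exact hlt

/-- An irreducible semigroup of `2 × 2` matrices with small traces has bounded distortion. -/
theorem exists_adjoint_lower_bound (S : Set (Matrix (Fin 2) (Fin 2) ℝ))
    (hmul : ∀ A ∈ S, ∀ B ∈ S, A * B ∈ S)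
    (hspan : ∀ x : EuclideanSpace ℝ (Fin 2), x ≠ 0 →
      Submodule.span ℝ {z | ∃ B ∈ S, Matrix.toEuclideanCLM (n := Fin 2) (𝕜 := ℝ) B x = z} = ⊤)
    (hunit : ∀ B ∈ S, IsUnit B) (htr : ∀ B ∈ S, B.trace ^ 2 ≤ 4 * |B.det|) :
    ∃ δ > 0, ∀ B ∈ S, ∀ y, δ * ‖Matrix.toEuclideanCLM (n := Fin 2) (𝕜 := ℝ) B‖ * ‖y‖ ≤
      ‖ContinuousLinearMap.adjoint (Matrix.toEuclideanCLM (n := Fin 2) (𝕜 := ℝ) B) y‖ := by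
  set Ψ := Matrix.toEuclideanCLM (n := Fin 2) (𝕜 := ℝ) with hΨ
  have hcΨ : Continuous (fun X => Ψ.symm X) :=
    (Ψ.symm.toAlgEquiv.toLinearMap).continuous_of_finiteDimensional
  have hpos : ∀ B ∈ S, 0 < ‖Ψ B‖ := fun B hB =>
    norm_pos_iff.2 ((hunit B hB).map Ψ).ne_zero
  -- a bound for the norm in terms of the determinant
  obtain ⟨C, hC⟩ : ∃ C : ℝ, ∀ B ∈ S, ‖Ψ B‖ ^ 2 ≤ C * |B.det| := by
    -- Normalised counterexamples accumulate at a singular `X` of norm one. Applied to products `B *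
    -- A`, the trace bound gives `(X * A).trace = 0` for `A ∈ S`, hence `X * A * X = 0`. As the
    -- vectors `A (X x)` span, `X` vanishes, a contradiction.
    by_contra hcon
    push Not at hcon
    choose B hBS hB using fun n : ℕ => hcon n
    have hsph : ∀ n, ‖Ψ (B n)‖⁻¹ • Ψ (B n) ∈
        Metric.sphere (0 : EuclideanSpace ℝ (Fin 2) →L[ℝ] EuclideanSpace ℝ (Fin 2)) 1 := fun n => by
      simp [norm_smul, (hpos _ (hBS n)).ne']
    have : ProperSpace (EuclideanSpace ℝ (Fin 2) →L[ℝ] EuclideanSpace ℝ (Fin 2)) :=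
      FiniteDimensional.proper ℝ _
    obtain ⟨Y, hY, σ, hσ, hlim⟩ := (isCompact_sphere _ _).tendsto_subseq hsph
    have hY1 : ‖Y‖ = 1 := by simpa using hY
    set X := Ψ.symm Y with hX
    set Xn : ℕ → Matrix (Fin 2) (Fin 2) ℝ := fun n => ‖Ψ (B (σ n))‖⁻¹ • B (σ n) with hXn
    have hXlim : Tendsto Xn atTop (𝓝 X) := by
      have := (hcΨ.tendsto Y).comp hlim
      refine this.congr fun n => ?_
      simp only [Function.comp]
      rw [map_smul, StarAlgEquiv.symm_apply_apply]
    have hdet : Tendsto (fun n => |(Xn n).det|) atTop (𝓝 0) := by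
      have h1 : Tendsto (fun n : ℕ => ((σ n : ℝ))⁻¹) atTop (𝓝 0) :=
        tendsto_inv_atTop_zero.comp (tendsto_natCast_atTop_atTop.comp hσ.tendsto_atTop)
      refine squeeze_zero' (Eventually.of_forall fun n => abs_nonneg _) ?_ h1
      filter_upwards [hσ.tendsto_atTop.eventually_gt_atTop 0] with n hn
      have hn' : (0 : ℝ) < σ n := by exact_mod_cast hn
      have h2 := hB (σ n)
      have h3 := hpos _ (hBS (σ n))
      rw [hXn]
      simp only [Matrix.det_smul, Fintype.card_fin]
      rw [abs_mul, abs_of_pos (by positivity), inv_pow, inv_mul_le_iff₀ (by positivity),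
        ← div_eq_mul_inv, le_div_iff₀ hn', mul_comm]
      exact h2.le
    have hXdet : X.det = 0 := by
      have h1 : Tendsto (fun n => |(Xn n).det|) atTop (𝓝 |X.det|) :=
        ((continuous_id.matrix_det.tendsto X).comp hXlim).abs
      exact abs_eq_zero.1 (tendsto_nhds_unique h1 hdet)
    have hXtr : ∀ A ∈ S, (X * A).trace = 0 := by
      intro A hA
      have h1 : Tendsto (fun n => (Xn n * A).trace ^ 2) atTop (𝓝 ((X * A).trace ^ 2)) := by
        have hcont : Continuous fun Z : Matrix (Fin 2) (Fin 2) ℝ => (Z * A).trace ^ 2 :=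
          ((continuous_id.matrix_mul continuous_const).matrix_trace).pow 2
        exact (hcont.tendsto X).comp hXlim
      have h2 : Tendsto (fun n => 4 * (|(Xn n).det| * |A.det|)) atTop (𝓝 0) := by
        simpa using (hdet.mul_const |A.det|).const_mul 4
      have h3 : ∀ n, (Xn n * A).trace ^ 2 ≤ 4 * (|(Xn n).det| * |A.det|) := by
        intro n
        have h4 := htr _ (hmul _ (hBS (σ n)) A hA)
        have h5 := hpos _ (hBS (σ n))
        rw [← abs_mul, ← Matrix.det_mul, hXn]
        simp only [smul_mul_assoc, Matrix.trace_smul, Matrix.det_smul, Fintype.card_fin,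
          smul_eq_mul]
        rw [mul_pow, abs_mul, abs_of_pos (show 0 < ‖Ψ (B (σ n))‖⁻¹ ^ 2 by positivity)]
        calc ‖Ψ (B (σ n))‖⁻¹ ^ 2 * (B (σ n) * A).trace ^ 2
            ≤ ‖Ψ (B (σ n))‖⁻¹ ^ 2 * (4 * |(B (σ n) * A).det|) := by gcongr
          _ = _ := by ring
      have h6 : (X * A).trace ^ 2 ≤ 0 := le_of_tendsto_of_tendsto' h1 h2 h3
      exact pow_eq_zero_iff (two_ne_zero) |>.1 (le_antisymm h6 (sq_nonneg _))
    have hΨX : Ψ X = Y := StarAlgEquiv.apply_symm_apply _ _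
    obtain ⟨x, hx⟩ : ∃ x, Y x ≠ 0 := by
      by_contra h0
      push Not at h0
      have : Y = 0 := ContinuousLinearMap.ext h0
      rw [this, norm_zero] at hY1
      exact zero_ne_one hY1
    have hkill : ∀ z, Y z = 0 := by
      intro z
      have hz : z ∈ Submodule.span ℝ {z | ∃ B ∈ S, Ψ B (Y x) = z} := by
        rw [hspan _ hx]; trivial
      induction hz using Submodule.span_induction with
      | mem z hz =>
        obtain ⟨A, hA, rfl⟩ := hz
        rw [← hΨX, ← mul_apply_eq_comp, ← mul_apply_eq_comp, ← map_mul, ← map_mul,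
          mul_mul_self_fin_two X A hXdet, hXtr A hA, zero_smul, map_zero]
        rfl
      | zero => exact map_zero _
      | add x y _ _ hx hy => rw [map_add, hx, hy, add_zero]
      | smul a x _ hx => rw [map_smul, hx, smul_zero]
    exact hx (hkill x)
  -- the adjugate
  obtain ⟨K, hK0, hK⟩ : ∃ K > 0, ∀ A : Matrix (Fin 2) (Fin 2) ℝ,
      ‖Ψ (A.trace • 1 - A)‖ ≤ K * ‖Ψ A‖ := by
    set L : (EuclideanSpace ℝ (Fin 2) →L[ℝ] EuclideanSpace ℝ (Fin 2)) →ₗ[ℝ] ℝ :=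
      (Matrix.traceLinearMap (Fin 2) ℝ ℝ).comp Ψ.symm.toAlgEquiv.toLinearMap with hL
    set L' := LinearMap.toContinuousLinearMap L
    refine ⟨‖L'‖ * ‖(1 : EuclideanSpace ℝ (Fin 2) →L[ℝ] EuclideanSpace ℝ (Fin 2))‖ + 1,
      by positivity, fun A => ?_⟩
    have h1 : L' (Ψ A) = A.trace := by
      change (Ψ.symm (Ψ A)).trace = _
      rw [StarAlgEquiv.symm_apply_apply]
    rw [map_sub, map_smul, map_one]
    refine (norm_sub_le _ _).trans ?_
    rw [norm_smul, ← h1, add_mul, one_mul]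
    refine add_le_add ?_ le_rfl
    calc ‖L' (Ψ A)‖ * ‖(1 : EuclideanSpace ℝ (Fin 2) →L[ℝ] EuclideanSpace ℝ (Fin 2))‖
        ≤ (‖L'‖ * ‖Ψ A‖) * ‖(1 : EuclideanSpace ℝ (Fin 2) →L[ℝ] EuclideanSpace ℝ (Fin 2))‖ := by
          gcongr; exact L'.le_opNorm _
      _ = _ := by ring
  refine ⟨(|C| * K + 1)⁻¹, by positivity, fun B hB y => ?_⟩
  have hB0 := hpos B hB
  have h1 : |B.det| * ‖y‖ ≤ K * ‖Ψ B‖ * ‖ContinuousLinearMap.adjoint (Ψ B) y‖ := by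
    have e1 : B.det • y = ContinuousLinearMap.adjoint (Ψ (B.trace • 1 - B))
        (ContinuousLinearMap.adjoint (Ψ B) y) := by
      refine ext_inner_right ℝ fun x => ?_
      rw [ContinuousLinearMap.adjoint_inner_left, ContinuousLinearMap.adjoint_inner_left,
        ← mul_apply_eq_comp, ← map_mul, mul_trace_sub_self_fin_two, map_smul, map_one, smul_apply,
        one_apply_eq_self, inner_smul_left, inner_smul_right]
      rfl
    rw [← Real.norm_eq_abs, ← norm_smul, e1]
    refine (ContinuousLinearMap.le_opNorm _ _).trans ?_
    rw [LinearIsometryEquiv.norm_map]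
    gcongr
    exact hK B
  have h2 : ‖Ψ B‖ * ‖y‖ ≤ (|C| * K) * ‖ContinuousLinearMap.adjoint (Ψ B) y‖ := by
    have h3 : ‖Ψ B‖ ^ 2 ≤ |C| * |B.det| :=
      (hC B hB).trans (by gcongr; exact le_abs_self C)
    have h4 : ‖Ψ B‖ * (‖Ψ B‖ * ‖y‖) ≤
        ‖Ψ B‖ * ((|C| * K) * ‖ContinuousLinearMap.adjoint (Ψ B) y‖) := by
      calc ‖Ψ B‖ * (‖Ψ B‖ * ‖y‖) = ‖Ψ B‖ ^ 2 * ‖y‖ := by ring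
        _ ≤ |C| * |B.det| * ‖y‖ := by gcongr
        _ = |C| * (|B.det| * ‖y‖) := by ring
        _ ≤ |C| * (K * ‖Ψ B‖ * ‖ContinuousLinearMap.adjoint (Ψ B) y‖) := by gcongr
        _ = _ := by ring
    exact le_of_mul_le_mul_left h4 hB0
  rw [mul_assoc, inv_mul_le_iff₀ (by positivity)]
  refine h2.trans ?_
  gcongr
  linarith

end Plane

/-! ### From matrices to systems, and the cases of the theorem. -/

section Main

variable {d l : ℕ}

/-- The affine maps `x ↦ T i x + a i` as elements of `AffEnd`. -/
noncomputable def affSystem (T : Fin l → Matrix (Fin d) (Fin d) ℝ)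
    (a : Fin l → EuclideanSpace ℝ (Fin d)) (i : Fin l) : AffEnd (EuclideanSpace ℝ (Fin d)) :=
  ⟨Matrix.toEuclideanCLM (n := Fin d) (𝕜 := ℝ) (T i), a i⟩

variable {T : Fin l → Matrix (Fin d) (Fin d) ℝ} {a : Fin l → EuclideanSpace ℝ (Fin d)}
  {E : Set (EuclideanSpace ℝ (Fin d))}

theorem toEuclideanLin_apply_eq (M : Matrix (Fin d) (Fin d) ℝ) (x : EuclideanSpace ℝ (Fin d)) :
    Matrix.toEuclideanLin M x = Matrix.toEuclideanCLM (n := Fin d) (𝕜 := ℝ) M x := rfl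

theorem isSystem_affSystem (hIFS : IsAffineIFS T a)
    (hE : IsAttractor (fun i => affMap (T i) (a i)) E)
    (hplane : ¬ ∃ H : Set (EuclideanSpace ℝ (Fin d)), IsHyperplane H ∧ E ⊆ H) :
    IsSystem (affSystem T a) E where
  isUnit i := (hIFS.1 i).map (Matrix.toEuclideanCLM (n := Fin d) (𝕜 := ℝ))
  contr := by
    obtain ⟨-, c, hc0, hc1, hc⟩ := hIFS
    refine ⟨c, hc0, hc1, fun i => ContinuousLinearMap.opNorm_le_bound _ hc0.le fun x => ?_⟩
    have := hc i x 0
    rw [dist_eq_norm, dist_eq_norm, sub_zero] at this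
    have h2 : ‖Matrix.toEuclideanLin (T i) x‖ ≤ c * ‖x‖ := by simpa [affMap] using this
    exact h2
  compact := hE.2.1
  nonempty := hE.1
  eq_iUnion := hE.2.2
  not_subset v hv b hsub := hplane ⟨_, ⟨v, hv, b, rfl⟩, hsub⟩

theorem nFoldSum_eq_nsmul (n : ℕ) (E : Set (EuclideanSpace ℝ (Fin d))) : nFoldSum n E = n • E := by
  have h : n • E = ∑ _i : Fin n, E := by simp
  ext y
  rw [h, Set.mem_fintype_sum]
  constructor
  · rintro ⟨x, hx, rfl⟩
    exact ⟨x, hx, rfl⟩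
  · rintro ⟨x, hx, rfl⟩
    exact ⟨x, hx, rfl⟩

/-- The span of the orbit is invariant under the generators, and it contains `x`. -/
theorem span_eq_top_of_irreducible (hirr : IrreducibleTuple T) {x : EuclideanSpace ℝ (Fin d)}
    (hx : x ≠ 0) :
    Submodule.span ℝ {z | ∃ g ∈ monoid (affSystem T a), g.lin x = z} = ⊤ := by
  refine (hirr _ fun i v hv => ?_).resolve_left fun hbot => hx ?_
  · rw [toEuclideanLin_apply_eq]
    induction hv using Submodule.span_induction with
    | mem z hz =>
      obtain ⟨g, hg, rfl⟩ := hz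
      exact Submodule.subset_span ⟨affSystem T a i * g, mul_mem (IsSystem.mem_monoid i) hg, rfl⟩
    | zero => rw [map_zero]; exact zero_mem _
    | add x y _ _ hx hy => rw [map_add]; exact add_mem hx hy
    | smul a x _ hx => rw [map_smul]; exact Submodule.smul_mem _ _ hx
  · exact (Submodule.mem_bot ℝ).1 (hbot ▸ Submodule.subset_span ⟨1, one_mem _, rfl⟩)

/-- Elements of the semigroup are non-empty words, whence the strict contraction that the proximal
criterion requires. -/
theorem exists_lin_eq_of_mem_closure {M : Matrix (Fin d) (Fin d) ℝ}
    (hM : M ∈ Subsemigroup.closure (Set.range T)) (h : IsSystem (affSystem T a) E) :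
    ∃ g ∈ monoid (affSystem T a), ‖g.lin‖ < 1 ∧
      g.lin = Matrix.toEuclideanCLM (n := Fin d) (𝕜 := ℝ) M := by
  induction hM using Subsemigroup.closure_induction with
  | mem M hM =>
    obtain ⟨i, rfl⟩ := hM
    exact ⟨affSystem T a i, IsSystem.mem_monoid i, h.norm_gen_lt i, rfl⟩
  | mul M N _ _ hM hN =>
    obtain ⟨f, hf, hf1, rfl'⟩ := hM
    obtain ⟨g, hg, hg1, hgN⟩ := hN
    refine ⟨f * g, mul_mem hf hg, ?_, by rw [AffEnd.mul_lin, rfl', hgN, map_mul]⟩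
    rw [AffEnd.mul_lin]
    exact (norm_mul_le _ _).trans_lt ((mul_le_of_le_one_right (norm_nonneg _) hg1.le).trans_lt hf1)

theorem thick_of_irreducible_proximal [NeZero d] (h : IsSystem (affSystem T a) E)
    (hirr : IrreducibleTuple T) {g : AffEnd (EuclideanSpace ℝ (Fin d))}
    (hg : g ∈ monoid (affSystem T a)) (hg1 : ‖g.lin‖ < 1) {M : Matrix (Fin d) (Fin d) ℝ}
    (hgM : g.lin = Matrix.toEuclideanCLM (n := Fin d) (𝕜 := ℝ) M)
    (hdom : HasSimpleDominantEigenvalue M) :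
    ∃ n : ℕ, 1 ≤ n ∧ (interior (n • E)).Nonempty := by
  have hM : IsUnit M := by
    have := (h.isUnit_lin hg).map (Matrix.toEuclideanCLM (n := Fin d) (𝕜 := ℝ)).symm
    rwa [hgM, StarAlgEquiv.symm_apply_apply] at this
  obtain ⟨r, u, w, hr, hwu, hlim⟩ := exists_rank_one_limit M hM hdom
  rw [← hgM] at hlim
  exact h.thick_of_proximal hg hg1 hr hwu hlim
    (span_eq_top_of_irreducible hirr fun h0 => by simp [h0] at hwu)

/-- A dichotomy: a strictly contracting element with a simple dominant eigenvalue makes the system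
proximal; without one, all traces are small and the distortion is bounded. -/
theorem thick_of_irreducible_plane {T : Fin l → Matrix (Fin 2) (Fin 2) ℝ}
    {a : Fin l → EuclideanSpace ℝ (Fin 2)} {E : Set (EuclideanSpace ℝ (Fin 2))}
    (h : IsSystem (affSystem T a) E) (hirr : IrreducibleTuple T) :
    ∃ n : ℕ, 1 ≤ n ∧ (interior (n • E)).Nonempty := by
  set Ψ := Matrix.toEuclideanCLM (n := Fin 2) (𝕜 := ℝ) with hΨ
  by_cases hprox : ∃ g ∈ monoid (affSystem T a), ‖g.lin‖ < 1 ∧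
      HasSimpleDominantEigenvalue (Ψ.symm g.lin)
  · obtain ⟨g, hg, hg1, hdom⟩ := hprox
    exact thick_of_irreducible_proximal h hirr hg hg1
      (StarAlgEquiv.apply_symm_apply Ψ g.lin).symm hdom
  push Not at hprox
  set S : Set (Matrix (Fin 2) (Fin 2) ℝ) := {B | ∃ g ∈ monoid (affSystem T a), g.lin = Ψ B} with hS
  have hunit : ∀ B ∈ S, IsUnit B := by
    rintro B ⟨g, hg, hgB⟩
    have := (h.isUnit_lin hg).map Ψ.symm
    rwa [hgB, StarAlgEquiv.symm_apply_apply] at this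
  obtain ⟨δ, hδ, hlow⟩ := exists_adjoint_lower_bound S
    (by
      rintro A ⟨f, hf, hfA⟩ B ⟨g, hg, hgB⟩
      exact ⟨f * g, mul_mem hf hg, by rw [AffEnd.mul_lin, hfA, hgB, map_mul]⟩)
    (by
      intro x hx
      rw [← span_eq_top_of_irreducible (a := a) hirr hx]
      congr 1
      ext z
      constructor
      · rintro ⟨B, ⟨g, hg, hgB⟩, rfl⟩
        exact ⟨g, hg, by rw [hgB]⟩
      · rintro ⟨g, hg, rfl⟩
        exact ⟨Ψ.symm g.lin, ⟨g, hg, (StarAlgEquiv.apply_symm_apply Ψ g.lin).symm⟩,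
          by rw [← hΨ, StarAlgEquiv.apply_symm_apply]⟩)
    hunit
    (by
      rintro B ⟨g, hg, hgB⟩
      have hB : Ψ.symm g.lin = B := by rw [hgB, StarAlgEquiv.symm_apply_apply]
      -- The identity is not a strict contraction and escapes `hprox`; it satisfies the trace bound
      -- with equality.
      rcases h.eq_one_or_norm_lt hg with rfl | hg1
      · have : B = 1 := by rw [← hB, AffEnd.one_lin, map_one]
        rw [this]
        norm_num [Matrix.trace_one]
      · by_contra hlt
        push Not at hlt
        exact hprox g hg hg1 (hB ▸ hasSimpleDominantEigenvalue_of_trace B hlt))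
  refine h.thick_of_conformal hδ fun g hg y => ?_
  have := hlow (Ψ.symm g.lin) ⟨g, hg, (StarAlgEquiv.apply_symm_apply Ψ g.lin).symm⟩ y
  rwa [← hΨ, StarAlgEquiv.apply_symm_apply] at this

/-- A common invariant line makes the linear parts triangular. Unless they commute, the comparison
of the diagonal entries `α i` and `γ i` in modulus selects one of the three triangular criteria. -/
theorem thick_of_reducible_plane {T : Fin l → Matrix (Fin 2) (Fin 2) ℝ}
    {a : Fin l → EuclideanSpace ℝ (Fin 2)} {E : Set (EuclideanSpace ℝ (Fin 2))}
    (h : IsSystem (affSystem T a) E) (hred : ¬ IrreducibleTuple T) :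
    ∃ n : ℕ, 1 ≤ n ∧ (interior (n • E)).Nonempty := by
  set φ := affSystem T a with hφ
  by_cases hcomm : ∀ i j, (φ i).lin * (φ j).lin = (φ j).lin * (φ i).lin
  · exact h.thick_of_comm hcomm
  push Not at hcomm
  unfold IrreducibleTuple at hred
  push Not at hred
  obtain ⟨W, hW, hbot, htop⟩ := hred
  obtain ⟨e, heW, he⟩ := Submodule.exists_mem_ne_zero_of_ne_bot hbot
  obtain ⟨y, hyW, hy⟩ := Submodule.exists_mem_ne_zero_of_ne_bot
    (fun h0 : Wᗮ = ⊥ => htop (Submodule.orthogonal_eq_bot_iff.1 h0))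
  set ξ : EuclideanSpace ℝ (Fin 2) →L[ℝ] ℝ := innerSL ℝ y with hξdef
  have hξx : ∀ x, ξ x = ⟪y, x⟫_ℝ := fun x => rfl
  have hξW : ∀ x ∈ W, ξ x = 0 := fun x hx => by
    rw [hξx, real_inner_comm]; exact (Submodule.mem_orthogonal _ _).1 hyW x hx
  have hξy : ξ y ≠ 0 := fun h0 => hy (inner_self_eq_zero.1 h0)
  have hξ : ξ ≠ 0 := fun h0 => hξy (by rw [h0]; rfl)
  have hker : ∀ x, ξ x = 0 → ∃ s : ℝ, x = s • e := by
    have : Fact (Module.finrank ℝ (EuclideanSpace ℝ (Fin 2)) = 1 + 1) := ⟨by simp⟩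
    have hfr := Submodule.finrank_orthogonal_span_singleton (𝕜 := ℝ) (n := 1) hy
    have hmem : ∀ x, ξ x = 0 → x ∈ (ℝ ∙ y)ᗮ := fun x hx =>
      Submodule.mem_orthogonal_singleton_iff_inner_right.2 hx
    intro x hx
    obtain ⟨s, hs⟩ := (finrank_eq_one_iff_of_nonzero' (⟨e, hmem e (hξW e heW)⟩ : (ℝ ∙ y)ᗮ)
      (fun h0 => he (congrArg Subtype.val h0))).1 hfr ⟨x, hmem x hx⟩
    exact ⟨s, (congrArg Subtype.val hs).symm⟩
  have hWi : ∀ i, (φ i).lin e ∈ W := fun i => hW i e heW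
  choose α hα using fun i => hker _ (hξW _ (hWi i))
  set γ : Fin l → ℝ := fun i => ξ ((φ i).lin y) / ξ y with hγ
  have htri : ∀ i, IsTri e ξ (φ i).lin (α i) (γ i) := by
    refine fun i => ⟨hα i, fun x => ?_⟩
    obtain ⟨s, hs⟩ := hker (x - (ξ x / ξ y) • y) (by
      rw [map_sub, map_smul, smul_eq_mul, div_mul_cancel₀ _ hξy, sub_self])
    have hx : x = (ξ x / ξ y) • y + s • e := by rw [← hs]; abel
    conv_lhs => rw [hx]
    rw [map_add, map_smul, map_smul, hα, map_add, map_smul, map_smul, map_smul, hξW e heW, hγ]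
    simp only [smul_eq_mul]
    ring
  by_cases h1 : ∃ i, |α i| < |γ i|
  · obtain ⟨i, hi⟩ := h1
    exact h.thick_of_tri_quotient htri hξ hker (hξW e heW) hcomm hi
  push Not at h1
  by_cases h2 : ∃ i, |γ i| < |α i|
  · obtain ⟨i, hi⟩ := h2
    exact h.thick_of_tri_line htri he hξ hker (hξW e heW) hcomm h1 hi
  push Not at h2
  exact h.thick_of_tri_balanced htri hξ hker hcomm fun i => le_antisymm (h1 i) (h2 i)

end Main

end SelfAffine

theorem theorem1p6 {d l : ℕ} (hd : 2 ≤ d) (T : Fin l → Matrix (Fin d) (Fin d) ℝ)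
    (a : Fin l → EuclideanSpace ℝ (Fin d)) (hIFS : SelfAffine.IsAffineIFS T a)
    (E : Set (EuclideanSpace ℝ (Fin d)))
    (hE : SelfAffine.IsAttractor (fun i => SelfAffine.affMap (T i) (a i)) E)
    (hplane : ¬ ∃ H : Set (EuclideanSpace ℝ (Fin d)), SelfAffine.IsHyperplane H ∧ E ⊆ H)
    (hcond : (∀ i j, T i * T j = T j * T i) ∨
      (SelfAffine.IrreducibleTuple T ∧
        ∃ M ∈ Subsemigroup.closure (Set.range T), SelfAffine.HasSimpleDominantEigenvalue M) ∨
      d = 2) :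
    SelfAffine.ArithmeticallyThick E := by
  have h := SelfAffine.isSystem_affSystem hIFS hE hplane
  suffices hmain : ∃ n : ℕ, 1 ≤ n ∧ (interior (n • E)).Nonempty by
    obtain ⟨n, hn, hint⟩ := hmain
    exact ⟨n, hn, by rwa [SelfAffine.nFoldSum_eq_nsmul]⟩
  rcases hcond with hcomm | ⟨hirr, M, hM, hdom⟩ | rfl
  · refine h.thick_of_comm fun i j => ?_
    let Ψ := Matrix.toEuclideanCLM (n := Fin d) (𝕜 := ℝ)
    change Ψ (T i) * Ψ (T j) = Ψ (T j) * Ψ (T i)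
    rw [← map_mul, hcomm, map_mul]
  · have : NeZero d := ⟨by omega⟩
    obtain ⟨g, hg, hg1, hgM⟩ := SelfAffine.exists_lin_eq_of_mem_closure hM h
    exact SelfAffine.thick_of_irreducible_proximal h hirr hg hg1 hgM hdom
  · by_cases hirr : SelfAffine.IrreducibleTuple T
    · exact SelfAffine.thick_of_irreducible_plane h hirr
    · exact SelfAffine.thick_of_reducible_plane h hirr
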